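/- Let $m\in\{0,1,2,\dots,\infty\}$. A \emph{$C^m$ family of differentiable manifolds} (of dimension $n$) is a surjective $C^m$ map $\alpha\colon X\to S$ of (Hausdorff, finite-dimensional) $C^m$ manifolds together with a cover of $X$ by open sets $U_i$ and $C^m$ diffeomorphisms $\Phi_i=(\Phi_{i,1},\alpha)\colon U_i\to V_i\times W_i$ over $S$, with $V_i\subset\mathbb R^n$ and $W_i\subset S$ open, such that every $\Phi_{i,1}\circ\Phi_j^{-1}$ is $C^\infty$ in the variable $v\in V_j$ and all its derivatives with respect to $v$, of any order $\geq 0$, are $C^m$ functions on the open subset of $V_j\times W_j$ where they are defined. A function on an open subset of $X$, with values in a finite-dimensional real vector space, is \emph{adapted} if in the charts $\Phi_i$ it is $C^\infty$ in $v$ and all its $v$-derivatives, of any order $\geq 0$, are $C^m$. A \emph{morphism} of $C^m$ families from $X\to S$ to $Y\to T$ is a commutative square of $C^m$ maps $F\colon X\to Y$, $f\colon S\to T$ such that the composition of $F$ with the vertical coordinates $\Psi_{j,1}$ of $Y$ is adapted. Each fiber $X_s=\alpha^{-1}(s)$ is a $C^\infty$ manifold with charts $\Phi_{i,1}|_{X_s}$,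 and for a nonempty $C^\infty$ manifold $M$ the product family $M\times T\to T$ has the charts $\varphi\times\mathrm{id}_T$, $\varphi$ a chart of $M$. A \emph{$C^m$ family of differentiable vector bundles} of rank $r$ (real or complex) on $\alpha$ is a vector bundle on $X$ with an atlas of local trivializations whose transition matrices are adapted; an isomorphism of such families is a vector bundle isomorphism, over the identity of the total space of the family of manifolds, which, together with its inverse, is given by matrices of adapted functions in these trivializations. The family $\alpha$ is a family of \emph{compact} manifolds if $\alpha$ is proper. Let $\alpha\colon X\to S$ be a $C^m$ family of compact differentiable manifolds, let $E$ be a $C^m$ family of (real or complex) differentiable vector bundles on it, and let $s_0\in S$. Then there is an open neighborhood $U_0$ of $s_0$ such that, for every open $U$ with $s_0\in U\subset U_0$, there is an isomorphism of $C^m$ families of differentiable manifolds, over the identity of $U$, $$\Theta\colon \alpha^{-1}(U)\xrightarrow{\ \sim\ } X_{s_0}\times U,$$ with $\Theta(x)=(x,s_0)$ for $x\in X_{s_0}$, such that, if $q\colon\alpha^{-1}(U)\to X_{s_0}$ is the composition of $\Theta$ with the projection to $X_{s_0}$, the restriction of $E$ to $\alpha^{-1}(U)$ is isomorphic, as a $C^m$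 family of differentiable vector bundles, to $q^*(E_{s_0})$, where $E_{s_0}=E|_{X_{s_0}}$. -/

import Mathlib

open Set Bundle TopologicalSpace
open scoped Manifold ContDiff Topology

noncomputable section

/-- Let `T` be a manifold and `Ω` an open subset of `ℝⁿ × T`.  A function `f` on `Ω` is *adapted* if
it is `C^∞` in the variable `v ∈ ℝⁿ` for every fixed `t ∈ T`, and all its derivatives with respect to
`v`, of any order (including `f` itself, for order `0`), are `C^m` functions of `(v, t)`. -/
def VertAdaptedOn (m : ℕ∞) {n : ℕ} {ET HT T : Type*} [NormedAddCommGroup ET] [NormedSpace ℝ ET]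
    [TopologicalSpace HT] (J : ModelWithCorners ℝ ET HT) [TopologicalSpace T] [ChartedSpace HT T]
    {G : Type*} [NormedAddCommGroup G] [NormedSpace ℝ G]
    (f : EuclideanSpace ℝ (Fin n) × T → G) (Ω : Set (EuclideanSpace ℝ (Fin n) × T)) : Prop :=
  (∀ p ∈ Ω, ContDiffAt ℝ ∞ (fun v => f (v, p.2)) p.1) ∧
  ∀ k : ℕ, ContMDiffOn ((𝓡 n).prod J)
    𝓘(ℝ, ContinuousMultilinearMap ℝ (fun _ : Fin k => EuclideanSpace ℝ (Fin n)) G) m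
    (fun p => iteratedFDeriv ℝ k (fun v => f (v, p.2)) p.1) Ω

/-- A structure of `C^m` family of differentiable manifolds of dimension `n` on `α : X → S`:
`α` is a surjective `C^m` map, and `X` is covered by `C^m` diffeomorphisms over `S` from open
subsets of `X` to products `V × W`, with `V ⊆ ℝⁿ` and `W ⊆ S` open, such that the `ℝⁿ`-components of
the changes of charts are adapted. The structure is given through one of its atlases. -/
structure CmFamily (m : ℕ∞) (n : ℕ)
    {EX HX X : Type*} [NormedAddCommGroup EX] [NormedSpace ℝ EX] [TopologicalSpace HX]
    (I : ModelWithCorners ℝ EX HX) [TopologicalSpace X] [ChartedSpace HX X]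
    {ES HS S : Type*} [NormedAddCommGroup ES] [NormedSpace ℝ ES] [TopologicalSpace HS]
    (J : ModelWithCorners ℝ ES HS) [TopologicalSpace S] [ChartedSpace HS S]
    (α : X → S) where
  surjective : Function.Surjective α
  contMDiff : ContMDiff I J m α
  charts : Set (OpenPartialHomeomorph X (EuclideanSpace ℝ (Fin n) × S))
  exists_mem_source : ∀ x : X, ∃ Φ ∈ charts, x ∈ Φ.source
  target_eq : ∀ Φ ∈ charts, ∃ (V : Set (EuclideanSpace ℝ (Fin n))) (W : Set S),
    IsOpen V ∧ IsOpen W ∧ Φ.target = V ×ˢ W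
  over_base : ∀ Φ ∈ charts, ∀ x ∈ Φ.source, (Φ x).2 = α x
  contMDiffOn_chart : ∀ Φ ∈ charts, ContMDiffOn I ((𝓡 n).prod J) m Φ Φ.source
  contMDiffOn_chart_symm : ∀ Φ ∈ charts, ContMDiffOn ((𝓡 n).prod J) I m Φ.symm Φ.target
  adapted_change : ∀ Φ ∈ charts, ∀ Φ' ∈ charts,
    VertAdaptedOn m J (fun p => (Φ' (Φ.symm p)).1) (Φ.target ∩ Φ.symm ⁻¹' Φ'.source)

namespace CmFamily

section Basic

variable {m : ℕ∞} {n : ℕ}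
  {EX HX X : Type*} [NormedAddCommGroup EX] [NormedSpace ℝ EX] [TopologicalSpace HX]
  {I : ModelWithCorners ℝ EX HX} [TopologicalSpace X] [ChartedSpace HX X]
  {ES HS S : Type*} [NormedAddCommGroup ES] [NormedSpace ℝ ES] [TopologicalSpace HS]
  {J : ModelWithCorners ℝ ES HS} [TopologicalSpace S] [ChartedSpace HS S]
  {α : X → S}

/-- A function `f` on an open subset `O` of the total space is adapted if it is `C^∞` in the vertical
coordinates and all its vertical derivatives are `C^m`. -/
def AdaptedOn (𝓕 : CmFamily m n I J α) {G : Type*} [NormedAddCommGroup G] [NormedSpace ℝ G]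
    (f : X → G) (O : Set X) : Prop :=
  ∀ Φ ∈ 𝓕.charts, VertAdaptedOn m J (fun p => f (Φ.symm p)) (Φ.target ∩ Φ.symm ⁻¹' O)

/-- Morphisms of `C^m` families: commutative squares of `C^m` maps `(F, f)` such that the composition
of `F` with any vertical coordinate is adapted. -/
structure IsMorphism (𝓕 : CmFamily m n I J α) {n' : ℕ}
    {EY HY Y : Type*} [NormedAddCommGroup EY] [NormedSpace ℝ EY] [TopologicalSpace HY]
    {I' : ModelWithCorners ℝ EY HY} [TopologicalSpace Y] [ChartedSpace HY Y]
    {ET HT T : Type*} [NormedAddCommGroup ET] [NormedSpace ℝ ET] [TopologicalSpace HT]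
    {J' : ModelWithCorners ℝ ET HT} [TopologicalSpace T] [ChartedSpace HT T]
    {β : Y → T} (𝓖 : CmFamily m n' I' J' β) (F : X → Y) (f : S → T) : Prop where
  comm : ∀ x, β (F x) = f (α x)
  contMDiff_total : ContMDiff I I' m F
  contMDiff_base : ContMDiff J J' m f
  adapted : ∀ Ψ ∈ 𝓖.charts, 𝓕.AdaptedOn (fun x => (Ψ (F x)).1) (F ⁻¹' Ψ.source)

/-- An isomorphism, over the identity of the base `S`, of `C^m` families over `S`. -/
structure Iso (𝓕 : CmFamily m n I J α)
    {EY HY Y : Type*} [NormedAddCommGroup EY] [NormedSpace ℝ EY] [TopologicalSpace HY]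
    {I' : ModelWithCorners ℝ EY HY} [TopologicalSpace Y] [ChartedSpace HY Y]
    {β : Y → S} (𝓖 : CmFamily m n I' J β) where
  toHomeomorph : X ≃ₜ Y
  isMorphism : 𝓕.IsMorphism 𝓖 toHomeomorph id
  isMorphism_symm : 𝓖.IsMorphism 𝓕 toHomeomorph.symm id

/-! ### The fibres -/

/-- The fibre `X_s` of the family, with the subspace topology. -/
@[ext]
structure Fiber (𝓕 : CmFamily m n I J α) (s : S) where
  val : X
  property : α val = s

instance (𝓕 : CmFamily m n I J α) (s : S) : TopologicalSpace (𝓕.Fiber s) :=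
  TopologicalSpace.induced Fiber.val inferInstance

instance (𝓕 : CmFamily m n I J α) (s : S) : Nonempty (𝓕.Fiber s) :=
  let ⟨x, hx⟩ := 𝓕.surjective s
  ⟨⟨x, hx⟩⟩

/-- The inclusion of the fibre `X_s` in the total space. -/
def fiberIncl (𝓕 : CmFamily m n I J α) (s : S) : C(𝓕.Fiber s, X) :=
  ⟨Fiber.val, continuous_induced_dom⟩

lemma apply_symm (𝓕 : CmFamily m n I J α)
    {Φ : OpenPartialHomeomorph X (EuclideanSpace ℝ (Fin n) × S)} (hΦ : Φ ∈ 𝓕.charts)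
    {p : EuclideanSpace ℝ (Fin n) × S} (hp : p ∈ Φ.target) : α (Φ.symm p) = p.2 := by
  rw [← 𝓕.over_base Φ hΦ _ (Φ.map_target hp), Φ.right_inv hp]

/-- The point of the fibre `X_s` with vertical coordinates `v` in the chart `Φ` (an arbitrary point of
`X_s` if there is none). -/
def fiberChartInv (𝓕 : CmFamily m n I J α) (s : S)
    (Φ : OpenPartialHomeomorph X (EuclideanSpace ℝ (Fin n) × S)) (hΦ : Φ ∈ 𝓕.charts)
    (v : EuclideanSpace ℝ (Fin n)) : 𝓕.Fiber s :=
  open Classical in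
  if h : (v, s) ∈ Φ.target then ⟨Φ.symm (v, s), 𝓕.apply_symm hΦ h⟩ else Classical.arbitrary _

lemma fiberChartInv_val (𝓕 : CmFamily m n I J α) (s : S)
    (Φ : OpenPartialHomeomorph X (EuclideanSpace ℝ (Fin n) × S)) (hΦ : Φ ∈ 𝓕.charts)
    {v : EuclideanSpace ℝ (Fin n)} (hv : (v, s) ∈ Φ.target) :
    (𝓕.fiberChartInv s Φ hΦ v).1 = Φ.symm (v, s) := by
  unfold fiberChartInv
  rw [dif_pos hv]

/-- The chart of the fibre `X_s` obtained by restricting the vertical coordinates of `Φ`. -/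
def fiberChart (𝓕 : CmFamily m n I J α) (s : S)
    (Φ : OpenPartialHomeomorph X (EuclideanSpace ℝ (Fin n) × S)) (hΦ : Φ ∈ 𝓕.charts) :
    OpenPartialHomeomorph (𝓕.Fiber s) (EuclideanSpace ℝ (Fin n)) where
  toFun x := (Φ x.1).1
  invFun := 𝓕.fiberChartInv s Φ hΦ
  source := {x | x.1 ∈ Φ.source}
  target := {v | (v, s) ∈ Φ.target}
  map_source' := by
    rintro ⟨x, rfl⟩ hx
    have := Φ.map_source hx
    rwa [← Prod.mk.eta (p := Φ x), 𝓕.over_base Φ hΦ x hx] at this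
  map_target' := by
    intro v hv
    change (𝓕.fiberChartInv s Φ hΦ v).1 ∈ Φ.source
    rw [𝓕.fiberChartInv_val s Φ hΦ hv]
    exact Φ.map_target hv
  left_inv' := by
    rintro ⟨x, rfl⟩ hx
    have h1 : ((Φ x).1, α x) = Φ x := by rw [← 𝓕.over_base Φ hΦ x hx]
    have h2 : ((Φ x).1, α x) ∈ Φ.target := by rw [h1]; exact Φ.map_source hx
    apply Fiber.ext
    change (𝓕.fiberChartInv _ Φ hΦ (Φ x).1).1 = x
    rw [𝓕.fiberChartInv_val _ Φ hΦ h2, h1]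
    exact Φ.left_inv hx
  right_inv' := by
    intro v hv
    rw [𝓕.fiberChartInv_val s Φ hΦ hv, Φ.right_inv hv]
  open_source := Φ.open_source.preimage (𝓕.fiberIncl s).continuous
  open_target := Φ.open_target.preimage (by fun_prop)
  continuousOn_toFun := continuous_fst.comp_continuousOn
    (Φ.continuousOn.comp (𝓕.fiberIncl s).continuous.continuousOn (fun _ hx => hx))
  continuousOn_invFun := by
    have hind : Topology.IsInducing (𝓕.fiberIncl s) := ⟨rfl⟩
    rw [hind.continuousOn_iff]
    have : ContinuousOn (fun v => Φ.symm (v, s)) {v | (v, s) ∈ Φ.target} :=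
      Φ.symm.continuousOn.comp (by fun_prop) (fun _ hv => hv)
    exact this.congr fun v hv => 𝓕.fiberChartInv_val s Φ hΦ hv

lemma fiberChart_symm_val (𝓕 : CmFamily m n I J α) (s : S)
    (Φ : OpenPartialHomeomorph X (EuclideanSpace ℝ (Fin n) × S)) (hΦ : Φ ∈ 𝓕.charts)
    {v : EuclideanSpace ℝ (Fin n)} (hv : (v, s) ∈ Φ.target) :
    ((𝓕.fiberChart s Φ hΦ).symm v).1 = Φ.symm (v, s) :=
  𝓕.fiberChartInv_val s Φ hΦ hv

/-- The manifold structure of the fibres. -/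
instance (𝓕 : CmFamily m n I J α) (s : S) :
    ChartedSpace (EuclideanSpace ℝ (Fin n)) (𝓕.Fiber s) where
  atlas := {φ | ∃ (Φ : _) (hΦ : Φ ∈ 𝓕.charts), φ = 𝓕.fiberChart s Φ hΦ}
  chartAt x := 𝓕.fiberChart s (𝓕.exists_mem_source x.1).choose
    (𝓕.exists_mem_source x.1).choose_spec.1
  mem_chart_source x := (𝓕.exists_mem_source x.1).choose_spec.2
  chart_mem_atlas _ := ⟨_, _, rfl⟩

instance (𝓕 : CmFamily m n I J α) (s : S) : IsManifold (𝓡 n) ∞ (𝓕.Fiber s) := by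
  apply isManifold_of_contDiffOn
  rintro _ _ ⟨Φ, hΦ, rfl⟩ ⟨Φ', hΦ', rfl⟩
  intro v hv
  have hv1 : (v, s) ∈ Φ.target := hv.1.1
  have hv2 : ((𝓕.fiberChart s Φ hΦ).symm v).1 ∈ Φ'.source := hv.1.2
  rw [𝓕.fiberChart_symm_val s Φ hΦ hv1] at hv2
  have key := ((𝓕.adapted_change Φ hΦ Φ' hΦ').1 (v, s) ⟨hv1, hv2⟩).contDiffWithinAt
    (s := (𝓡 n).symm ⁻¹' ((𝓕.fiberChart s Φ hΦ).symm ≫ₕ (𝓕.fiberChart s Φ' hΦ')).source ∩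
      range (𝓡 n))
  refine key.congr_of_mem (fun w hw => ?_) hv
  have hw1 : (w, s) ∈ Φ.target := hw.1.1
  change (Φ' ((𝓕.fiberChart s Φ hΦ).symm w).1).1 = _
  rw [𝓕.fiberChart_symm_val s Φ hΦ hw1]

/-! ### Restriction to an open subset of the base -/

/-- The open subset `α⁻¹(U)` of the total space. -/
def preim (𝓕 : CmFamily m n I J α) (U : Opens S) : Opens X :=
  ⟨α ⁻¹' U, U.isOpen.preimage 𝓕.contMDiff.continuous⟩

/-- The projection `α⁻¹(U) → U`. -/
def preimProj (𝓕 : CmFamily m n I J α) (U : Opens S) (x : 𝓕.preim U) : U := ⟨α x.1, x.2⟩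

/-- The inclusion of `α⁻¹(U)` in the total space. -/
def preimIncl (𝓕 : CmFamily m n I J α) (U : Opens S) : C(𝓕.preim U, X) :=
  ⟨Subtype.val, continuous_subtype_val⟩

/-- The point of `α⁻¹(U)` over `p.2` with vertical coordinates `p.1` in the chart `Φ` (an arbitrary
point over `p.2` if there is none). -/
def restrictChartInv (𝓕 : CmFamily m n I J α) (U : Opens S)
    (Φ : OpenPartialHomeomorph X (EuclideanSpace ℝ (Fin n) × S)) (hΦ : Φ ∈ 𝓕.charts)
    (p : EuclideanSpace ℝ (Fin n) × U) : 𝓕.preim U :=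
  ⟨(𝓕.fiberChartInv p.2.1 Φ hΦ p.1).1, by
    change α _ ∈ U
    rw [(𝓕.fiberChartInv p.2.1 Φ hΦ p.1).property]
    exact p.2.2⟩

lemma restrictChartInv_val (𝓕 : CmFamily m n I J α) (U : Opens S)
    (Φ : OpenPartialHomeomorph X (EuclideanSpace ℝ (Fin n) × S)) (hΦ : Φ ∈ 𝓕.charts)
    {p : EuclideanSpace ℝ (Fin n) × U} (hp : (p.1, p.2.1) ∈ Φ.target) :
    (𝓕.restrictChartInv U Φ hΦ p).1 = Φ.symm (p.1, p.2.1) :=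
  𝓕.fiberChartInv_val p.2.1 Φ hΦ hp

/-- The chart of `α⁻¹(U)`, with values in `ℝⁿ × U`, obtained by restricting `Φ`. -/
def restrictChart (𝓕 : CmFamily m n I J α) (U : Opens S)
    (Φ : OpenPartialHomeomorph X (EuclideanSpace ℝ (Fin n) × S)) (hΦ : Φ ∈ 𝓕.charts) :
    OpenPartialHomeomorph (𝓕.preim U) (EuclideanSpace ℝ (Fin n) × U) where
  toFun x := ((Φ x.1).1, 𝓕.preimProj U x)
  invFun := 𝓕.restrictChartInv U Φ hΦ
  source := {x | x.1 ∈ Φ.source}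
  target := {p | (p.1, p.2.1) ∈ Φ.target}
  map_source' := by
    rintro ⟨x, hU⟩ hx
    have := Φ.map_source hx
    rwa [← Prod.mk.eta (p := Φ x), 𝓕.over_base Φ hΦ x hx] at this
  map_target' := by
    intro p hp
    change (𝓕.restrictChartInv U Φ hΦ p).1 ∈ Φ.source
    rw [𝓕.restrictChartInv_val U Φ hΦ hp]
    exact Φ.map_target hp
  left_inv' := by
    rintro ⟨x, hU⟩ hx
    have h1 : ((Φ x).1, α x) = Φ x := by rw [← 𝓕.over_base Φ hΦ x hx]
    have h2 : ((Φ x).1, α x) ∈ Φ.target := by rw [h1]; exact Φ.map_source hx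
    apply Subtype.ext
    rw [𝓕.restrictChartInv_val U Φ hΦ h2]
    change Φ.symm ((Φ x).1, α x) = x
    rw [h1]
    exact Φ.left_inv hx
  right_inv' := by
    rintro ⟨v, t⟩ hp
    refine Prod.ext ?_ (Subtype.ext ?_)
    · change (Φ (𝓕.restrictChartInv U Φ hΦ (v, t)).1).1 = v
      rw [𝓕.restrictChartInv_val U Φ hΦ hp, Φ.right_inv hp]
    · exact (𝓕.fiberChartInv t.1 Φ hΦ v).property
  open_source := Φ.open_source.preimage continuous_subtype_val
  open_target := Φ.open_target.preimage (by fun_prop)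
  continuousOn_toFun := by
    refine ContinuousOn.prodMk ?_ ?_
    · exact continuous_fst.comp_continuousOn
        (Φ.continuousOn.comp continuous_subtype_val.continuousOn (fun _ hx => hx))
    · exact (Continuous.subtype_mk
        (𝓕.contMDiff.continuous.comp continuous_subtype_val) _).continuousOn
  continuousOn_invFun := by
    rw [Topology.IsInducing.subtypeVal.continuousOn_iff]
    have : ContinuousOn (fun p : EuclideanSpace ℝ (Fin n) × U => Φ.symm (p.1, p.2.1))
        {p | (p.1, p.2.1) ∈ Φ.target} :=
      Φ.symm.continuousOn.comp (by fun_prop) (fun _ hv => hv)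
    exact this.congr fun p hp => 𝓕.restrictChartInv_val U Φ hΦ hp

lemma restrictChart_symm_val (𝓕 : CmFamily m n I J α) (U : Opens S)
    (Φ : OpenPartialHomeomorph X (EuclideanSpace ℝ (Fin n) × S)) (hΦ : Φ ∈ 𝓕.charts)
    {p : EuclideanSpace ℝ (Fin n) × U} (hp : (p.1, p.2.1) ∈ Φ.target) :
    ((𝓕.restrictChart U Φ hΦ).symm p).1 = Φ.symm (p.1, p.2.1) :=
  𝓕.restrictChartInv_val U Φ hΦ hp

lemma contMDiff_fst_val (m : ℕ∞) (n : ℕ) (U : Opens S) : ContMDiff ((𝓡 n).prod J) ((𝓡 n).prod J) m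
    (fun p : EuclideanSpace ℝ (Fin n) × U => (p.1, p.2.1)) :=
  contMDiff_fst.prodMk (contMDiff_subtype_val.comp contMDiff_snd)

lemma contMDiff_preimProj (𝓕 : CmFamily m n I J α) (U : Opens S) :
    ContMDiff I J m (𝓕.preimProj U) := by
  intro x
  have h : ContMDiffAt I J m (Subtype.val ∘ 𝓕.preimProj U) x :=
    𝓕.contMDiff.contMDiffAt.comp x contMDiff_subtype_val.contMDiffAt
  exact ChartedSpace.liftPropWithinAt_subtypeVal_comp_iff .. |>.1 h

/-- The restriction `α⁻¹(U) → U` of a `C^m` family to an open subset `U` of the base. -/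
def restrict (𝓕 : CmFamily m n I J α) (U : Opens S) : CmFamily m n I J (𝓕.preimProj U) where
  surjective t := by
    obtain ⟨x, hx⟩ := 𝓕.surjective t.1
    exact ⟨⟨x, by change α x ∈ U; rw [hx]; exact t.2⟩, Subtype.ext hx⟩
  contMDiff := 𝓕.contMDiff_preimProj U
  charts := {Ψ | ∃ (Φ : _) (hΦ : Φ ∈ 𝓕.charts), Ψ = 𝓕.restrictChart U Φ hΦ}
  exists_mem_source x := by
    obtain ⟨Φ, hΦ, hx⟩ := 𝓕.exists_mem_source x.1
    exact ⟨_, ⟨Φ, hΦ, rfl⟩, hx⟩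
  target_eq := by
    rintro _ ⟨Φ, hΦ, rfl⟩
    obtain ⟨V, W, hV, hW, h⟩ := 𝓕.target_eq Φ hΦ
    refine ⟨V, Subtype.val ⁻¹' W, hV, hW.preimage continuous_subtype_val, ?_⟩
    ext p
    change (p.1, p.2.1) ∈ Φ.target ↔ _
    rw [h]
    rfl
  over_base := by
    rintro _ ⟨Φ, hΦ, rfl⟩ x hx
    rfl
  contMDiffOn_chart := by
    rintro _ ⟨Φ, hΦ, rfl⟩
    refine ContMDiffOn.prodMk ?_ (𝓕.contMDiff_preimProj U).contMDiffOn
    exact contMDiff_fst.comp_contMDiffOn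
      ((𝓕.contMDiffOn_chart Φ hΦ).comp contMDiff_subtype_val.contMDiffOn fun _ hx => hx)
  contMDiffOn_chart_symm := by
    rintro _ ⟨Φ, hΦ, rfl⟩
    intro p hp
    have := ((𝓕.contMDiffOn_chart_symm Φ hΦ).comp
      (contMDiff_fst_val (J := J) m n U).contMDiffOn
      (s := (𝓕.restrictChart U Φ hΦ).target) fun _ hx => hx) p hp
    have h : ContMDiffWithinAt ((𝓡 n).prod J) I m
        (Subtype.val ∘ (𝓕.restrictChart U Φ hΦ).symm) (𝓕.restrictChart U Φ hΦ).target p :=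
      this.congr_of_mem (fun q hq => 𝓕.restrictChart_symm_val U Φ hΦ hq) hp
    exact ChartedSpace.liftPropWithinAt_subtypeVal_comp_iff .. |>.1 h
  adapted_change := by
    rintro _ ⟨Φ, hΦ, rfl⟩ _ ⟨Φ', hΦ', rfl⟩
    obtain ⟨h1, h2⟩ := 𝓕.adapted_change Φ hΦ Φ' hΦ'
    have hsub : ∀ p ∈ (𝓕.restrictChart U Φ hΦ).target ∩
        (𝓕.restrictChart U Φ hΦ).symm ⁻¹' (𝓕.restrictChart U Φ' hΦ').source,
        (p.1, p.2.1) ∈ Φ.target ∩ Φ.symm ⁻¹' Φ'.source := by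
      intro p hp
      refine ⟨hp.1, ?_⟩
      have : ((𝓕.restrictChart U Φ hΦ).symm p).1 ∈ Φ'.source := hp.2
      rwa [𝓕.restrictChart_symm_val U Φ hΦ hp.1] at this
    have heq : ∀ p ∈ (𝓕.restrictChart U Φ hΦ).target,
        (fun v => ((𝓕.restrictChart U Φ' hΦ') ((𝓕.restrictChart U Φ hΦ).symm (v, p.2))).1)
          =ᶠ[𝓝 p.1] fun v => (Φ' (Φ.symm (v, p.2.1))).1 := by
      intro p hp
      have hopen : IsOpen {v : EuclideanSpace ℝ (Fin n) | (v, p.2.1) ∈ Φ.target} :=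
        Φ.open_target.preimage (by fun_prop)
      filter_upwards [hopen.mem_nhds (show p.1 ∈ _ from hp)] with v hv
      change (Φ' ((𝓕.restrictChart U Φ hΦ).symm (v, p.2)).1).1 = _
      rw [𝓕.restrictChart_symm_val U Φ hΦ hv]
    refine ⟨fun p hp => (h1 _ (hsub p hp)).congr_of_eventuallyEq (heq p hp.1), fun k => ?_⟩
    refine ((h2 k).comp (contMDiff_fst_val (J := J) m n U).contMDiffOn hsub).congr ?_
    intro p hp
    exact ((heq p hp.1).iteratedFDeriv ℝ k).eq_of_nhds

end Basic

/-! ### Product families -/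

section Product

variable {n : ℕ}
  (M : Type*) [TopologicalSpace M] [ChartedSpace (EuclideanSpace ℝ (Fin n)) M]
  [IsManifold (𝓡 n) ∞ M] [Nonempty M]
  {ET HT : Type*} [NormedAddCommGroup ET] [NormedSpace ℝ ET] [TopologicalSpace HT]
  (J : ModelWithCorners ℝ ET HT) (T : Type*) [TopologicalSpace T] [ChartedSpace HT T]

/-- The product family `M × T → T`, where `M` is a `C^∞` manifold; its charts are the maps `φ × id`,
where `φ` is a chart of `M`. -/
def prod (m : ℕ∞) : CmFamily m n ((𝓡 n).prod J) J (Prod.snd : M × T → T) where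
  surjective := Prod.snd_surjective
  contMDiff := contMDiff_snd
  charts := {Ψ | ∃ φ ∈ atlas (EuclideanSpace ℝ (Fin n)) M,
    Ψ = φ.prod (OpenPartialHomeomorph.refl T)}
  exists_mem_source x := ⟨_, ⟨_, chart_mem_atlas (EuclideanSpace ℝ (Fin n)) x.1, rfl⟩,
    ⟨mem_chart_source _ _, mem_univ _⟩⟩
  target_eq := by
    rintro _ ⟨φ, hφ, rfl⟩
    exact ⟨φ.target, univ, φ.open_target, isOpen_univ, rfl⟩
  over_base := by
    rintro _ ⟨φ, hφ, rfl⟩ x hx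
    rfl
  contMDiffOn_chart := by
    rintro _ ⟨φ, hφ, rfl⟩
    have hm : IsManifold (𝓡 n) m M := IsManifold.of_le (n := ∞) (by exact_mod_cast le_top)
    have := contMDiffOn_of_mem_maximalAtlas (IsManifold.subset_maximalAtlas (I := 𝓡 n) (n := m) hφ)
    exact ContMDiffOn.prodMk (this.comp contMDiffOn_fst fun x hx => hx.1) contMDiffOn_snd
  contMDiffOn_chart_symm := by
    rintro _ ⟨φ, hφ, rfl⟩
    have hm : IsManifold (𝓡 n) m M := IsManifold.of_le (n := ∞) (by exact_mod_cast le_top)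
    have := contMDiffOn_symm_of_mem_maximalAtlas
      (IsManifold.subset_maximalAtlas (I := 𝓡 n) (n := m) hφ)
    exact ContMDiffOn.prodMk (this.comp contMDiffOn_fst fun x hx => hx.1) contMDiffOn_snd
  adapted_change := by
    rintro _ ⟨φ, hφ, rfl⟩ _ ⟨φ', hφ', rfl⟩
    have hsub : ∀ p ∈ (φ.prod (OpenPartialHomeomorph.refl T)).target ∩
        (φ.prod (OpenPartialHomeomorph.refl T)).symm ⁻¹'
          (φ'.prod (OpenPartialHomeomorph.refl T)).source,
        p.1 ∈ (φ.symm ≫ₕ φ').source := fun p hp => ⟨hp.1.1, hp.2.1⟩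
    have hsm : ContDiffOn ℝ ∞ (fun v => φ' (φ.symm v)) (φ.symm ≫ₕ φ').source := by
      have h := HasGroupoid.compatible (G := contDiffGroupoid ∞ (𝓡 n)) hφ hφ'
      rw [← contMDiffOn_iff_contDiffOn]
      exact contMDiffOn_of_mem_contDiffGroupoid h
    have hopen := (φ.symm ≫ₕ φ').open_source
    refine ⟨fun p hp => hsm.contDiffAt (hopen.mem_nhds (hsub p hp)), fun k => ?_⟩
    have hk : ContDiffOn ℝ ∞ (iteratedFDeriv ℝ k (fun v => φ' (φ.symm v)))
        (φ.symm ≫ₕ φ').source := by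
      intro v hv
      exact ((hsm.contDiffAt (hopen.mem_nhds hv)).iteratedFDeriv_right (m := ∞)
        (by exact_mod_cast le_top)).contDiffWithinAt
    have hk' := (contMDiffOn_iff_contDiffOn.2 hk).of_le
      (m := (m : WithTop ℕ∞)) (by exact_mod_cast le_top)
    exact hk'.comp contMDiffOn_fst hsub

variable {M J T}

/-- The map `X → M` obtained by composing an isomorphism of `X` with a product `M × T` with the
projection of the product to `M`. -/
def Iso.toFst {m : ℕ∞} {EX HX X : Type*} [NormedAddCommGroup EX] [NormedSpace ℝ EX]
    [TopologicalSpace HX] {I : ModelWithCorners ℝ EX HX} [TopologicalSpace X] [ChartedSpace HX X]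
    {α : X → T} {𝓕 : CmFamily m n I J α} (Θ : 𝓕.Iso (CmFamily.prod M J T m)) : C(X, M) :=
  ⟨fun x => (Θ.toHomeomorph x).1, continuous_fst.comp Θ.toHomeomorph.continuous⟩

end Product

/-! ### Families of vector bundles -/

section VectorBundle

variable {m : ℕ∞} {n : ℕ}
  {EX HX X : Type*} [NormedAddCommGroup EX] [NormedSpace ℝ EX] [TopologicalSpace HX]
  {I : ModelWithCorners ℝ EX HX} [TopologicalSpace X] [ChartedSpace HX X]
  {ES HS S : Type*} [NormedAddCommGroup ES] [NormedSpace ℝ ES] [TopologicalSpace HS]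
  {J : ModelWithCorners ℝ ES HS} [TopologicalSpace S] [ChartedSpace HS S]
  {α : X → S}

/-- A (real or complex) vector bundle of rank `r` on the total space of a `C^m` family of manifolds
is a `C^m` family of differentiable vector bundles if the changes of trivialization are adapted. -/
def IsVectorBundleFamily (𝓕 : CmFamily m n I J α) (𝕜 : Type*) [RCLike 𝕜] (r : ℕ)
    (E : X → Type*) [TopologicalSpace (TotalSpace (EuclideanSpace 𝕜 (Fin r)) E)]
    [∀ x, AddCommMonoid (E x)] [∀ x, Module 𝕜 (E x)] [∀ x, TopologicalSpace (E x)]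
    [FiberBundle (EuclideanSpace 𝕜 (Fin r)) E] [VectorBundle 𝕜 (EuclideanSpace 𝕜 (Fin r)) E] :
    Prop :=
  ∀ (e e' : Trivialization (EuclideanSpace 𝕜 (Fin r)) (π (EuclideanSpace 𝕜 (Fin r)) E))
    [MemTrivializationAtlas e] [MemTrivializationAtlas e'],
    𝓕.AdaptedOn (fun x => (e.coordChangeL 𝕜 e' x :
      EuclideanSpace 𝕜 (Fin r) →L[𝕜] EuclideanSpace 𝕜 (Fin r))) (e.baseSet ∩ e'.baseSet)

/-- An isomorphism of `C^m` families of differentiable vector bundles (over the identity of the total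
space): a family of linear isomorphisms of the fibres which, like its inverse, is given in adapted
local trivializations by a matrix of adapted functions. -/
structure VectorBundleIso (𝓕 : CmFamily m n I J α) (𝕜 : Type*) [RCLike 𝕜] (r : ℕ)
    (E : X → Type*) [TopologicalSpace (TotalSpace (EuclideanSpace 𝕜 (Fin r)) E)]
    [∀ x, AddCommMonoid (E x)] [∀ x, Module 𝕜 (E x)] [∀ x, TopologicalSpace (E x)]
    [FiberBundle (EuclideanSpace 𝕜 (Fin r)) E] [VectorBundle 𝕜 (EuclideanSpace 𝕜 (Fin r)) E]
    (E' : X → Type*) [TopologicalSpace (TotalSpace (EuclideanSpace 𝕜 (Fin r)) E')]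
    [∀ x, AddCommMonoid (E' x)] [∀ x, Module 𝕜 (E' x)] [∀ x, TopologicalSpace (E' x)]
    [FiberBundle (EuclideanSpace 𝕜 (Fin r)) E'] [VectorBundle 𝕜 (EuclideanSpace 𝕜 (Fin r)) E']
    where
  toEquiv : ∀ x, E x ≃L[𝕜] E' x
  adapted : ∀ (e : Trivialization (EuclideanSpace 𝕜 (Fin r)) (π (EuclideanSpace 𝕜 (Fin r)) E))
    (e' : Trivialization (EuclideanSpace 𝕜 (Fin r)) (π (EuclideanSpace 𝕜 (Fin r)) E'))
    [MemTrivializationAtlas e] [MemTrivializationAtlas e'],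
    𝓕.AdaptedOn (fun x => (e'.continuousLinearMapAt 𝕜 x) ∘L (toEquiv x : E x →L[𝕜] E' x) ∘L
      (e.symmL 𝕜 x)) (e.baseSet ∩ e'.baseSet)
  adapted_symm : ∀ (e : Trivialization (EuclideanSpace 𝕜 (Fin r)) (π (EuclideanSpace 𝕜 (Fin r)) E))
    (e' : Trivialization (EuclideanSpace 𝕜 (Fin r)) (π (EuclideanSpace 𝕜 (Fin r)) E'))
    [MemTrivializationAtlas e] [MemTrivializationAtlas e'],
    𝓕.AdaptedOn (fun x => (e.continuousLinearMapAt 𝕜 x) ∘L ((toEquiv x).symm : E' x →L[𝕜] E x) ∘L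
      (e'.symmL 𝕜 x)) (e.baseSet ∩ e'.baseSet)

end VectorBundle

end CmFamily

end

/-! This is an Ehresmann-type theorem, but for small `m` (possibly `0`) there are no liftable vector
fields to integrate. The trivialization is instead built from an adapted retraction `q` onto the
fibre `X_{s₀}`, defined near that fibre and equal to the identity on it; then `Θ = (q, α)`.

Construction of `q` (`exists_retraction`). Inside one chart, the vertical coordinate is a
retraction. Finitely many charts cover the compact fibre, and they are absorbed one at a time
(`exists_extend_retraction`): in the chart `Φ` the current `q` is replaced by the combination `(1 -
ψ) φ(q) + ψ Φ₁`, with `ψ` a cutoff. On `X_{s₀}` the two terms agree, so near the fibre the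
combination stays in the domain of the chart; no embedding or tubular neighbourhood is needed.

Why `(q, α)` is an isomorphism (`exists_trivializing_retraction`, `isoOfVertEtale`). Along `X_{s₀}`
the vertical derivative of `q` is the identity, so it is invertible nearby. A version of the inverse
function theorem that requires only continuity in the parameter (`vert_inverse_function`) makes `(q,
α)` locally injective and open. Compactness of the fibre gives injectivity on a neighbourhood of it
and surjectivity onto `X_{s₀}` for all parameters near `s₀`; properness turns neighbourhoods of the
fibre into preimages of neighbourhoods of `s₀`. The inverse is adapted because its vertical
derivative is the inverse of that of `q`, which propagates regularity by induction
(`VertAdaptedAt.of_vert_inverse`).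

The bundle (`exists_bundleMatrix`). Local trivializations around finitely many points identify `E x`
with `E (q x)`; these identifications are added with cutoff weights. On `X_{s₀}`, where `q x = x`,
the sum is a positive multiple of the identity, so it is invertible near the fibre.

All conditions are imposed fibre by fibre over an open set `U₀`, so they restrict to every smaller
`U`. The calculus rests on `VertContDiffAt`, which is recursive in the vertical derivative, so that
chain rules are proved by induction on its order. -/

/-! ### Germs of adapted functions -/

section VertCalculus

open Filter

universe u v

variable {m : ℕ∞} {n : ℕ} {ET HT T : Type*} [NormedAddCommGroup ET] [NormedSpace ℝ ET]
  [TopologicalSpace HT] {J : ModelWithCorners ℝ ET HT} [TopologicalSpace T] [ChartedSpace HT T]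
  {G : Type u} [NormedAddCommGroup G] [NormedSpace ℝ G]
  {G' : Type v} [NormedAddCommGroup G'] [NormedSpace ℝ G']

/-- The partial derivative of `f : ℝⁿ × T → G` with respect to the variable in `ℝⁿ`. -/
noncomputable def vertFDeriv {n : ℕ} {T : Type*} {G : Type u} [NormedAddCommGroup G]
    [NormedSpace ℝ G] (f : EuclideanSpace ℝ (Fin n) × T → G) :
    EuclideanSpace ℝ (Fin n) × T → (EuclideanSpace ℝ (Fin n) →L[ℝ] G) :=
  fun p => fderiv ℝ (fun v => f (v, p.2)) p.1

/-- The function `f` is, near `p`, of class `C^m` together with its first `k` vertical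
derivatives. -/
def VertContDiffAt (m : ℕ∞) {n : ℕ} {ET HT T : Type*} [NormedAddCommGroup ET] [NormedSpace ℝ ET]
    [TopologicalSpace HT] (J : ModelWithCorners ℝ ET HT) [TopologicalSpace T] [ChartedSpace HT T] :
    (k : ℕ) → {G : Type u} → [NormedAddCommGroup G] → [NormedSpace ℝ G] →
    (f : EuclideanSpace ℝ (Fin n) × T → G) → (p : EuclideanSpace ℝ (Fin n) × T) → Prop
  | 0, G, _, _, f, p => ∀ᶠ p' in 𝓝 p, ContMDiffAt ((𝓡 n).prod J) 𝓘(ℝ, G) m f p'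
  | k + 1, G, _, _, f, p => (∀ᶠ p' in 𝓝 p, ContMDiffAt ((𝓡 n).prod J) 𝓘(ℝ, G) m f p') ∧
      (∀ᶠ p' in 𝓝 p, DifferentiableAt ℝ (fun v => f (v, p'.2)) p'.1) ∧
      VertContDiffAt m J k (vertFDeriv f) p

/-- The germ of `f` at `p` is adapted. -/
def VertAdaptedAt (m : ℕ∞) {n : ℕ} {ET HT T : Type*} [NormedAddCommGroup ET] [NormedSpace ℝ ET]
    [TopologicalSpace HT] (J : ModelWithCorners ℝ ET HT) [TopologicalSpace T] [ChartedSpace HT T]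
    {G : Type u} [NormedAddCommGroup G] [NormedSpace ℝ G]
    (f : EuclideanSpace ℝ (Fin n) × T → G) (p : EuclideanSpace ℝ (Fin n) × T) : Prop :=
  ∀ k, VertContDiffAt m J k f p

lemma eventually_slice {P : EuclideanSpace ℝ (Fin n) × T → Prop}
    {p : EuclideanSpace ℝ (Fin n) × T} (h : ∀ᶠ p' in 𝓝 p, P p') : ∀ᶠ v in 𝓝 p.1, P (v, p.2) :=
  ((by fun_prop : Continuous fun v : EuclideanSpace ℝ (Fin n) => (v, p.2)).tendsto' p.1 p
    rfl).eventually h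

lemma vertFDeriv_congr {f g : EuclideanSpace ℝ (Fin n) × T → G}
    {p : EuclideanSpace ℝ (Fin n) × T} (h : f =ᶠ[𝓝 p] g) : vertFDeriv f =ᶠ[𝓝 p] vertFDeriv g := by
  filter_upwards [eventually_eventually_nhds.2 h] with p' hp'
  exact Filter.EventuallyEq.fderiv_eq (eventually_slice hp')

/-! ### Calculus rules for functions with `k` vertical derivatives of class `C^m`. -/

namespace VertContDiffAt

lemma eventually_contMDiffAt {k : ℕ} {f : EuclideanSpace ℝ (Fin n) × T → G}
    {p : EuclideanSpace ℝ (Fin n) × T} (h : VertContDiffAt m J k f p) :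
    ∀ᶠ p' in 𝓝 p, ContMDiffAt ((𝓡 n).prod J) 𝓘(ℝ, G) m f p' := by
  cases k with
  | zero => exact h
  | succ k => exact h.1

lemma contMDiffAt {k : ℕ} {f : EuclideanSpace ℝ (Fin n) × T → G}
    {p : EuclideanSpace ℝ (Fin n) × T} (h : VertContDiffAt m J k f p) :
    ContMDiffAt ((𝓡 n).prod J) 𝓘(ℝ, G) m f p :=
  h.eventually_contMDiffAt.self_of_nhds

lemma continuousAt {k : ℕ} {f : EuclideanSpace ℝ (Fin n) × T → G}
    {p : EuclideanSpace ℝ (Fin n) × T} (h : VertContDiffAt m J k f p) : ContinuousAt f p :=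
  h.contMDiffAt.continuousAt

lemma congr {k : ℕ} {f g : EuclideanSpace ℝ (Fin n) × T → G}
    {p : EuclideanSpace ℝ (Fin n) × T} (h : VertContDiffAt m J k f p) (hfg : g =ᶠ[𝓝 p] f) :
    VertContDiffAt m J k g p := by
  induction k generalizing G with
  | zero =>
    filter_upwards [h.eventually_contMDiffAt, eventually_eventually_nhds.2 hfg] with p' h1 h2
    exact h1.congr_of_eventuallyEq h2
  | succ k ih =>
    refine ⟨?_, ?_, ih h.2.2 (vertFDeriv_congr hfg)⟩
    · filter_upwards [h.eventually_contMDiffAt, eventually_eventually_nhds.2 hfg] with p' h1 h2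
      exact h1.congr_of_eventuallyEq h2
    · filter_upwards [h.2.1, eventually_eventually_nhds.2 hfg] with p' h1 h2
      exact h1.congr_of_eventuallyEq (eventually_slice h2)

lemma of_succ {k : ℕ} {f : EuclideanSpace ℝ (Fin n) × T → G}
    {p : EuclideanSpace ℝ (Fin n) × T} (h : VertContDiffAt m J (k + 1) f p) :
    VertContDiffAt m J k f p := by
  induction k generalizing G with
  | zero => exact h.1
  | succ k ih => exact ⟨h.1, h.2.1, ih h.2.2⟩

lemma const (k : ℕ) (c : G) (p : EuclideanSpace ℝ (Fin n) × T) :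
    VertContDiffAt m J k (fun _ => c) p := by
  induction k generalizing G with
  | zero => exact Eventually.of_forall fun _ => contMDiffAt_const
  | succ k ih =>
    refine ⟨Eventually.of_forall fun _ => contMDiffAt_const,
      Eventually.of_forall fun _ => differentiableAt_const _, (ih 0).congr ?_⟩
    exact Eventually.of_forall fun p' => by simp [vertFDeriv]

lemma fst (k : ℕ) (p : EuclideanSpace ℝ (Fin n) × T) :
    VertContDiffAt m J k (fun q : EuclideanSpace ℝ (Fin n) × T => q.1) p := by
  cases k with
  | zero => exact Eventually.of_forall fun _ => contMDiffAt_fst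
  | succ k =>
    refine ⟨Eventually.of_forall fun _ => contMDiffAt_fst,
      Eventually.of_forall fun _ => differentiableAt_id,
      (const k (ContinuousLinearMap.id ℝ _) p).congr ?_⟩
    exact Eventually.of_forall fun p' => fderiv_fun_id

lemma clm_comp {k : ℕ} {f : EuclideanSpace ℝ (Fin n) × T → G}
    {p : EuclideanSpace ℝ (Fin n) × T} (h : VertContDiffAt m J k f p) (L : G →L[ℝ] G') :
    VertContDiffAt m J k (fun q => L (f q)) p := by
  induction k generalizing G G' with
  | zero =>
    filter_upwards [h.eventually_contMDiffAt] with p' h1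
    exact L.contMDiff.contMDiffAt.comp p' h1
  | succ k ih =>
    refine ⟨?_, ?_, (ih h.2.2 (ContinuousLinearMap.compL ℝ (EuclideanSpace ℝ (Fin n)) G G'
      L)).congr ?_⟩
    · filter_upwards [h.eventually_contMDiffAt] with p' h1
      exact L.contMDiff.contMDiffAt.comp p' h1
    · filter_upwards [h.2.1] with p' h1
      exact L.differentiableAt.comp p'.1 h1
    · filter_upwards [h.2.1] with p' h1
      exact (L.hasFDerivAt.comp p'.1 h1.hasFDerivAt).fderiv

lemma add {k : ℕ} {f g : EuclideanSpace ℝ (Fin n) × T → G}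
    {p : EuclideanSpace ℝ (Fin n) × T} (hf : VertContDiffAt m J k f p)
    (hg : VertContDiffAt m J k g p) : VertContDiffAt m J k (fun q => f q + g q) p := by
  induction k generalizing G with
  | zero =>
    filter_upwards [hf.eventually_contMDiffAt, hg.eventually_contMDiffAt] with p' h1 h2
    exact h1.add h2
  | succ k ih =>
    refine ⟨?_, ?_, (ih hf.2.2 hg.2.2).congr ?_⟩
    · filter_upwards [hf.eventually_contMDiffAt, hg.eventually_contMDiffAt] with p' h1 h2
      exact h1.add h2
    · filter_upwards [hf.2.1, hg.2.1] with p' h1 h2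
      exact h1.add h2
    · filter_upwards [hf.2.1, hg.2.1] with p' h1 h2
      exact (h1.hasFDerivAt.add h2.hasFDerivAt).fderiv

lemma prodMk {k : ℕ} {f : EuclideanSpace ℝ (Fin n) × T → G}
    {g : EuclideanSpace ℝ (Fin n) × T → G'}
    {p : EuclideanSpace ℝ (Fin n) × T} (hf : VertContDiffAt m J k f p)
    (hg : VertContDiffAt m J k g p) : VertContDiffAt m J k (fun q => (f q, g q)) p := by
  refine ((hf.clm_comp (ContinuousLinearMap.inl ℝ G G')).add
    (hg.clm_comp (ContinuousLinearMap.inr ℝ G G'))).congr (Eventually.of_forall fun q => ?_)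
  simp

/-- By the chain rule the vertical derivative is `(Dφ ∘ f) ∘L ∂f`. Both factors have `k` vertical
derivatives and composition of linear maps is smooth, so the induction hypothesis applies to the
pair. It is thus used for products of spaces of linear maps, which is why `G₁` and `G₂` share a
universe. -/
lemma comp_contDiff_aux {k : ℕ} {G₁ G₂ : Type u} [NormedAddCommGroup G₁]
    [NormedSpace ℝ G₁] [NormedAddCommGroup G₂] [NormedSpace ℝ G₂]
    {f : EuclideanSpace ℝ (Fin n) × T → G₁}
    {p : EuclideanSpace ℝ (Fin n) × T} (hf : VertContDiffAt m J k f p) {φ : G₁ → G₂}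
    (hφ : ∀ᶠ y in 𝓝 (f p), ContDiffAt ℝ ∞ φ y) : VertContDiffAt m J k (fun q => φ (f q)) p := by
  induction k generalizing G₁ G₂ with
  | zero =>
    filter_upwards [hf.eventually_contMDiffAt, hf.continuousAt.eventually hφ] with p' h1 h2
    exact (h2.of_le (by exact_mod_cast le_top)).contMDiffAt.comp p' h1
  | succ k ih =>
    have hφ' : ∀ᶠ y in 𝓝 (f p), ContDiffAt ℝ ∞ (fderiv ℝ φ) y := by
      filter_upwards [hφ] with y hy
      exact hy.fderiv_right (by exact_mod_cast le_top)
    have h1 : VertContDiffAt m J k (fun q => fderiv ℝ φ (f q)) p := ih hf.of_succ hφ'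
    have h2 : VertContDiffAt m J k (fun q => (fderiv ℝ φ (f q)) ∘L (vertFDeriv f q)) p :=
      ih (φ := fun A : (G₁ →L[ℝ] G₂) × (EuclideanSpace ℝ (Fin n) →L[ℝ] G₁) => A.1 ∘L A.2)
        (h1.prodMk hf.2.2)
        (Eventually.of_forall fun A => (contDiff_fst.clm_comp contDiff_snd).contDiffAt)
    refine ⟨?_, ?_, h2.congr ?_⟩
    · filter_upwards [hf.eventually_contMDiffAt, hf.continuousAt.eventually hφ] with p' h1 h2
      exact (h2.of_le (by exact_mod_cast le_top)).contMDiffAt.comp p' h1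
    · filter_upwards [hf.2.1, hf.continuousAt.eventually hφ] with p' h1 h2
      exact (h2.differentiableAt (by simp)).comp p'.1 h1
    · filter_upwards [hf.2.1, hf.continuousAt.eventually hφ] with p' h1 h2
      exact ((h2.differentiableAt (by simp)).hasFDerivAt.comp p'.1 h1.hasFDerivAt).fderiv

lemma comp_contDiff {k : ℕ} {f : EuclideanSpace ℝ (Fin n) × T → G}
    {p : EuclideanSpace ℝ (Fin n) × T} (hf : VertContDiffAt m J k f p) {φ : G → G'}
    (hφ : ∀ᶠ y in 𝓝 (f p), ContDiffAt ℝ ∞ φ y) : VertContDiffAt m J k (fun q => φ (f q)) p := by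
  -- Lifting both spaces to a common universe makes the auxiliary lemma applicable.
  let e : ULift.{v} G ≃L[ℝ] G := ContinuousLinearEquiv.ulift
  let e' : ULift.{u} G' ≃L[ℝ] G' := ContinuousLinearEquiv.ulift
  have h1 := (hf.clm_comp (e.symm : G →L[ℝ] ULift.{v} G)).comp_contDiff_aux
    (φ := fun y => e'.symm (φ (e y))) (by
      have : Tendsto e (𝓝 (e.symm (f p))) (𝓝 (f p)) :=
        e.continuous.tendsto' _ _ (e.apply_symm_apply _)
      filter_upwards [this.eventually hφ] with y hy
      exact e'.symm.contDiff.contDiffAt.comp y (hy.comp y e.contDiff.contDiffAt))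
  refine (h1.clm_comp (e' : ULift.{u} G' →L[ℝ] G')).congr (Eventually.of_forall fun q => ?_)
  simp

/-- Change of the vertical variable. -/
lemma comp_vert {k : ℕ} {n' : ℕ} {f : EuclideanSpace ℝ (Fin n) × T → G}
    {h : EuclideanSpace ℝ (Fin n') × T → EuclideanSpace ℝ (Fin n)}
    {p : EuclideanSpace ℝ (Fin n') × T} (hf : VertContDiffAt m J k f (h p, p.2))
    (hh : VertContDiffAt m J k h p) : VertContDiffAt m J k (fun q => f (h q, q.2)) p := by
  have hc : ContinuousAt (fun q : EuclideanSpace ℝ (Fin n') × T => (h q, q.2)) p :=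
    hh.continuousAt.prodMk continuous_snd.continuousAt
  have h0 : ∀ᶠ q in 𝓝 p, ContMDiffAt ((𝓡 n').prod J) 𝓘(ℝ, G) m (fun q => f (h q, q.2)) q := by
    filter_upwards [hh.eventually_contMDiffAt, hc.eventually hf.eventually_contMDiffAt]
      with q h1 h2
    exact ContMDiffAt.comp q h2 (h1.prodMk contMDiffAt_snd)
  induction k generalizing G with
  | zero => exact h0
  | succ k ih =>
    -- The vertical derivative of the composite is `∂f(h, ·) ∘L ∂h`; the induction hypothesis
    -- handles the first factor.
    have h1 : VertContDiffAt m J k (fun q => vertFDeriv f (h q, q.2)) p := by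
      refine ih hf.2.2 hh.of_succ ?_
      filter_upwards [hh.eventually_contMDiffAt, hc.eventually hf.2.2.eventually_contMDiffAt]
        with q h1 h2
      exact ContMDiffAt.comp q h2 (h1.prodMk contMDiffAt_snd)
    refine ⟨h0, ?_, ((h1.prodMk hh.2.2).comp_contDiff (φ := fun A :
      (EuclideanSpace ℝ (Fin n) →L[ℝ] G) ×
        (EuclideanSpace ℝ (Fin n') →L[ℝ] EuclideanSpace ℝ (Fin n)) => A.1 ∘L A.2)
      (Eventually.of_forall fun A => (contDiff_fst.clm_comp contDiff_snd).contDiffAt)).congr ?_⟩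
    · filter_upwards [hh.2.1, hc.eventually hf.2.1] with q h1 h2
      exact DifferentiableAt.comp (g := fun v => f (v, q.2)) q.1 h2 h1
    · filter_upwards [hh.2.1, hc.eventually hf.2.1] with q h1 h2
      exact (HasFDerivAt.comp (g := fun v => f (v, q.2)) q.1 h2.hasFDerivAt h1.hasFDerivAt).fderiv

/-- Change of the parameter. -/
lemma comp_base {k : ℕ} {EB HB B : Type*} [NormedAddCommGroup EB] [NormedSpace ℝ EB]
    [TopologicalSpace HB] {K : ModelWithCorners ℝ EB HB} [TopologicalSpace B] [ChartedSpace HB B]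
    {f : EuclideanSpace ℝ (Fin n) × T → G} {τ : B → T} (hτ : ContMDiff K J m τ)
    {p : EuclideanSpace ℝ (Fin n) × B} (hf : VertContDiffAt m J k f (p.1, τ p.2)) :
    VertContDiffAt m K k (fun q => f (q.1, τ q.2)) p := by
  have hc : ContinuousAt (fun q : EuclideanSpace ℝ (Fin n) × B => (q.1, τ q.2)) p :=
    continuousAt_fst.prodMk (hτ.continuous.continuousAt.comp continuousAt_snd)
  induction k generalizing G with
  | zero =>
    filter_upwards [hc.eventually hf.eventually_contMDiffAt] with q h2
    exact ContMDiffAt.comp q h2 (contMDiffAt_fst.prodMk (hτ.contMDiffAt.comp q contMDiffAt_snd))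
  | succ k ih =>
    -- Vertical differentiation commutes definitionally with a change of parameter.
    refine ⟨?_, ?_, ih hf.2.2⟩
    · filter_upwards [hc.eventually hf.eventually_contMDiffAt] with q h2
      exact ContMDiffAt.comp q h2 (contMDiffAt_fst.prodMk (hτ.contMDiffAt.comp q contMDiffAt_snd))
    · filter_upwards [hc.eventually hf.2.1] with q h2
      exact h2

lemma contDiffAt_slice {k : ℕ} {f : EuclideanSpace ℝ (Fin n) × T → G}
    {p : EuclideanSpace ℝ (Fin n) × T} (h : VertContDiffAt m J k f p) :
    ContDiffAt ℝ k (fun v => f (v, p.2)) p.1 := by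
  induction k generalizing G with
  | zero =>
    rw [Nat.cast_zero, contDiffAt_zero]
    refine ⟨_, eventually_slice h.eventually_contMDiffAt, fun v hv => ?_⟩
    exact (ContinuousAt.comp (f := fun v => (v, p.2)) (x := v) (ContMDiffAt.continuousAt hv)
      (by fun_prop)).continuousWithinAt
  | succ k ih =>
    rw [Nat.cast_succ, contDiffAt_succ_iff_hasFDerivAt]
    exact ⟨fun v => vertFDeriv f (v, p.2),
      ⟨_, eventually_slice h.2.1, fun v hv => DifferentiableAt.hasFDerivAt hv⟩, ih h.2.2⟩

/-- Up to the isometry that curries the last variable, the derivative of order `k + 1` of `f` is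
that of order `k` of `vertFDeriv f`. -/
lemma contMDiffAt_iteratedFDeriv {k : ℕ} {f : EuclideanSpace ℝ (Fin n) × T → G}
    {p : EuclideanSpace ℝ (Fin n) × T} (h : VertContDiffAt m J k f p) :
    ContMDiffAt ((𝓡 n).prod J)
      𝓘(ℝ, ContinuousMultilinearMap ℝ (fun _ : Fin k => EuclideanSpace ℝ (Fin n)) G) m
      (fun p => iteratedFDeriv ℝ k (fun v => f (v, p.2)) p.1) p := by
  induction k generalizing G with
  | zero =>
    exact ((continuousMultilinearCurryFin0 ℝ (EuclideanSpace ℝ (Fin n)) G).symm :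
      G ≃ₗᵢ[ℝ] _).toContinuousLinearEquiv.contDiff.contMDiff.contMDiffAt.comp p h.contMDiffAt
  | succ k ih =>
    have := ((continuousMultilinearCurryRightEquiv' ℝ k (EuclideanSpace ℝ (Fin n)) G).symm :
      _ ≃ₗᵢ[ℝ] _).toContinuousLinearEquiv.contDiff.contMDiff.contMDiffAt.comp p (n := m) (ih h.2.2)
    refine this.congr_of_eventuallyEq (Eventually.of_forall fun q => ?_)
    exact iteratedFDeriv_succ_eq_comp_right

end VertContDiffAt

/-! ### Comparison of `VertAdaptedOn` with adapted germs. -/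

lemma contMDiffOn_linearIsometryEquiv_comp {E H M : Type*} [NormedAddCommGroup E]
    [NormedSpace ℝ E] [TopologicalSpace H] {I : ModelWithCorners ℝ E H} [TopologicalSpace M]
    [ChartedSpace H M] {N : WithTop ℕ∞} (e : G ≃ₗᵢ[ℝ] G') {f : M → G} {s : Set M}
    (hf : ContMDiffOn I 𝓘(ℝ, G) N f s) : ContMDiffOn I 𝓘(ℝ, G') N (fun x => e (f x)) s :=
  e.toContinuousLinearEquiv.contDiff.contMDiff.comp_contMDiffOn hf

set_option synthInstance.maxHeartbeats 200000 in
lemma contMDiffOn_curryRight {E E' H M : Type*} [NormedAddCommGroup E] [NormedSpace ℝ E]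
    [NormedAddCommGroup E'] [NormedSpace ℝ E'] [TopologicalSpace H] {I : ModelWithCorners ℝ E' H}
    [TopologicalSpace M] [ChartedSpace H M] {N : WithTop ℕ∞} (j : ℕ)
    {f : M → ContinuousMultilinearMap ℝ (fun _ : Fin (j + 1) => E) G} {s : Set M}
    (hf : ContMDiffOn I 𝓘(ℝ, ContinuousMultilinearMap ℝ (fun _ : Fin (j + 1) => E) G) N f s) :
    ContMDiffOn I 𝓘(ℝ, ContinuousMultilinearMap ℝ (fun _ : Fin j => E) (E →L[ℝ] G)) N
      (fun x => continuousMultilinearCurryRightEquiv' ℝ j E G (f x)) s :=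
  contMDiffOn_linearIsometryEquiv_comp
    (G' := ContinuousMultilinearMap ℝ (fun _ : Fin j => E) (E →L[ℝ] G))
    (continuousMultilinearCurryRightEquiv' ℝ j E G) hf

/-- Induction on `k`: `vertFDeriv f` is again adapted on `Ω`, because its iterated derivatives are
those of `f` of one order more, curried. -/
lemma VertAdaptedOn.vertContDiffAt {f : EuclideanSpace ℝ (Fin n) × T → G}
    {Ω : Set (EuclideanSpace ℝ (Fin n) × T)} (hΩ : IsOpen Ω) (h : VertAdaptedOn m J f Ω) (k : ℕ)
    {p : EuclideanSpace ℝ (Fin n) × T} (hp : p ∈ Ω) : VertContDiffAt m J k f p := by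
  induction k generalizing G with
  | zero =>
    filter_upwards [hΩ.mem_nhds hp] with q hq
    exact ((continuousMultilinearCurryFin0 ℝ (EuclideanSpace ℝ (Fin n)) G) :
      _ ≃ₗᵢ[ℝ] G).toContinuousLinearEquiv.contDiff.contMDiff.contMDiffAt.comp q
          ((h.2 0 q hq).contMDiffAt (hΩ.mem_nhds hq))
  | succ k ih =>
    refine ⟨?_, ?_, ih ⟨fun q hq => ?_, fun j => ?_⟩⟩
    · filter_upwards [hΩ.mem_nhds hp] with q hq
      exact ((continuousMultilinearCurryFin0 ℝ (EuclideanSpace ℝ (Fin n)) G) :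
        _ ≃ₗᵢ[ℝ] G).toContinuousLinearEquiv.contDiff.contMDiff.contMDiffAt.comp q
          ((h.2 0 q hq).contMDiffAt (hΩ.mem_nhds hq))
    · filter_upwards [hΩ.mem_nhds hp] with q hq
      exact (h.1 q hq).differentiableAt (by simp)
    · exact (h.1 q hq).fderiv_right (m := ∞) (by exact_mod_cast le_top)
    · have := contMDiffOn_curryRight j (h.2 (j + 1))
      refine this.congr fun q hq => ?_
      rw [iteratedFDeriv_succ_eq_comp_right]
      exact ((continuousMultilinearCurryRightEquiv' ℝ j
        (EuclideanSpace ℝ (Fin n)) G).apply_symm_apply _).symm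

lemma VertAdaptedOn.vertAdaptedAt {f : EuclideanSpace ℝ (Fin n) × T → G}
    {Ω : Set (EuclideanSpace ℝ (Fin n) × T)} (hΩ : IsOpen Ω) (h : VertAdaptedOn m J f Ω)
    {p : EuclideanSpace ℝ (Fin n) × T} (hp : p ∈ Ω) : VertAdaptedAt m J f p :=
  fun k => h.vertContDiffAt hΩ k hp

namespace VertAdaptedAt

lemma vertAdaptedOn {f : EuclideanSpace ℝ (Fin n) × T → G}
    {Ω : Set (EuclideanSpace ℝ (Fin n) × T)} (h : ∀ p ∈ Ω, VertAdaptedAt m J f p) :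
    VertAdaptedOn m J f Ω :=
  ⟨fun p hp => contDiffAt_infty.2 fun k => (h p hp k).contDiffAt_slice,
    fun k p hp => (h p hp k).contMDiffAt_iteratedFDeriv.contMDiffWithinAt⟩

variable {f : EuclideanSpace ℝ (Fin n) × T → G} {g : EuclideanSpace ℝ (Fin n) × T → G'}
  {p : EuclideanSpace ℝ (Fin n) × T}

lemma contMDiffAt (h : VertAdaptedAt m J f p) : ContMDiffAt ((𝓡 n).prod J) 𝓘(ℝ, G) m f p :=
  (h 0).contMDiffAt

lemma continuousAt (h : VertAdaptedAt m J f p) : ContinuousAt f p :=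
  h.contMDiffAt.continuousAt

lemma vertFDeriv (h : VertAdaptedAt m J f p) : VertAdaptedAt m J (vertFDeriv f) p :=
  fun k => (h (k + 1)).2.2

lemma eventually_hasFDerivAt (h : VertAdaptedAt m J f p) :
    ∀ᶠ q in 𝓝 p, HasFDerivAt (fun v => f (v, q.2)) (_root_.vertFDeriv f q) q.1 :=
  (h 1).2.1.mono fun _ hq => hq.hasFDerivAt

lemma congr {f' : EuclideanSpace ℝ (Fin n) × T → G} (h : VertAdaptedAt m J f p)
    (hf : f' =ᶠ[𝓝 p] f) : VertAdaptedAt m J f' p :=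
  fun k => (h k).congr hf

lemma const (c : G) (p : EuclideanSpace ℝ (Fin n) × T) : VertAdaptedAt m J (fun _ => c) p :=
  fun k => .const k c p

lemma fst (p : EuclideanSpace ℝ (Fin n) × T) :
    VertAdaptedAt m J (fun q : EuclideanSpace ℝ (Fin n) × T => q.1) p :=
  fun k => .fst k p

lemma prodMk (hf : VertAdaptedAt m J f p) (hg : VertAdaptedAt m J g p) :
    VertAdaptedAt m J (fun q => (f q, g q)) p :=
  fun k => (hf k).prodMk (hg k)

lemma comp_contDiff (hf : VertAdaptedAt m J f p) {φ : G → G'}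
    (hφ : ∀ᶠ y in 𝓝 (f p), ContDiffAt ℝ ∞ φ y) : VertAdaptedAt m J (fun q => φ (f q)) p :=
  fun k => (hf k).comp_contDiff hφ

lemma comp_vert {n' : ℕ} {h : EuclideanSpace ℝ (Fin n') × T → EuclideanSpace ℝ (Fin n)}
    {p : EuclideanSpace ℝ (Fin n') × T} (hf : VertAdaptedAt m J f (h p, p.2))
    (hh : VertAdaptedAt m J h p) : VertAdaptedAt m J (fun q => f (h q, q.2)) p :=
  fun k => (hf k).comp_vert (hh k)

lemma comp_base {EB HB B : Type*} [NormedAddCommGroup EB] [NormedSpace ℝ EB]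
    [TopologicalSpace HB] {K : ModelWithCorners ℝ EB HB} [TopologicalSpace B] [ChartedSpace HB B]
    {τ : B → T} (hτ : ContMDiff K J m τ)
    {p : EuclideanSpace ℝ (Fin n) × B} (hf : VertAdaptedAt m J f (p.1, τ p.2)) :
    VertAdaptedAt m K (fun q => f (q.1, τ q.2)) p :=
  fun k => (hf k).comp_base hτ

end VertAdaptedAt

end VertCalculus

/-! ### The inverse function theorem with parameters -/

section VertInverse

open Filter

lemma ContinuousLinearMap.IsInvertible.eventually {𝕜 E F : Type*} [NontriviallyNormedField 𝕜]
    [NormedAddCommGroup E] [NormedSpace 𝕜 E] [NormedAddCommGroup F] [NormedSpace 𝕜 F]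
    [CompleteSpace E] {A : E →L[𝕜] F} (hA : A.IsInvertible) : ∀ᶠ B in 𝓝 A, B.IsInvertible := by
  obtain ⟨e, rfl⟩ := hA
  exact e.nhds

variable {m : ℕ∞} {n l : ℕ} {T : Type*} [TopologicalSpace T]
  [ChartedSpace (EuclideanSpace ℝ (Fin l)) T]

/-- In a chart of `T`, the map `Γ(v, y) = (g(v, y), y)` has a block triangular derivative with
diagonal blocks `A` and the identity. Its local inverse is therefore `C^m`, and `h`, being
continuous, must be the first component of that inverse. -/
lemma contMDiffAt_of_vert_inverse [IsManifold (𝓡 l) m T]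
    {g h : EuclideanSpace ℝ (Fin n) × T → EuclideanSpace ℝ (Fin n)}
    {p : EuclideanSpace ℝ (Fin n) × T}
    (hg : ContMDiffAt ((𝓡 n).prod (𝓡 l)) (𝓡 n) m g (h p, p.2))
    {A : EuclideanSpace ℝ (Fin n) ≃L[ℝ] EuclideanSpace ℝ (Fin n)}
    (hA : HasFDerivAt (fun v => g (v, p.2))
      (A : EuclideanSpace ℝ (Fin n) →L[ℝ] EuclideanSpace ℝ (Fin n)) (h p))
    (hc : ∀ᶠ q in 𝓝 p, ContinuousAt h q) (hgh : ∀ᶠ q in 𝓝 p, g (h q, q.2) = q.1) :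
    ContMDiffAt ((𝓡 n).prod (𝓡 l)) (𝓡 n) m h p := by
  -- For `m = 0` the map `Γ` need not be differentiable in the parameter, but then the continuity of
  -- `h` is all that is claimed.
  rcases eq_or_ne m 0 with rfl | hm
  · obtain ⟨Ω, hΩ, hΩo, hp⟩ := eventually_nhds_iff.1 hc
    exact (contMDiffOn_zero_iff.2 fun q hq => (hΩ q hq).continuousWithinAt).contMDiffAt
      (hΩo.mem_nhds hp)
  have hm' : (m : WithTop ℕ∞) ≠ 0 := by exact_mod_cast hm
  set t := p.2 with ht
  let χ := extChartAt (𝓡 l) t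
  have hχt : χ.symm (χ t) = t := extChartAt_to_inv t
  have hsym : ContMDiffAt 𝓘(ℝ, EuclideanSpace ℝ (Fin l)) (𝓡 l) m χ.symm (χ t) :=
    (contMDiffOn_extChartAt_symm t).contMDiffAt (extChartAt_target_mem_nhds t)
  let ι : EuclideanSpace ℝ (Fin n) × EuclideanSpace ℝ (Fin l) → EuclideanSpace ℝ (Fin n) × T :=
    fun z => (z.1, χ.symm z.2)
  let κ : EuclideanSpace ℝ (Fin n) × T → EuclideanSpace ℝ (Fin n) × EuclideanSpace ℝ (Fin l) :=
    fun z => (z.1, χ z.2)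
  have hι : ∀ v, ContMDiffAt 𝓘(ℝ, EuclideanSpace ℝ (Fin n) × EuclideanSpace ℝ (Fin l))
      ((𝓡 n).prod (𝓡 l)) m ι (v, χ t) := fun v =>
    contDiff_fst.contMDiff.contMDiffAt.prodMk
      (ContMDiffAt.comp (v, χ t) (g := χ.symm) hsym contDiff_snd.contMDiff.contMDiffAt)
  have hκ : ContMDiffAt ((𝓡 n).prod (𝓡 l))
      𝓘(ℝ, EuclideanSpace ℝ (Fin n) × EuclideanSpace ℝ (Fin l)) m κ p :=
    contMDiffAt_fst.prodMk_space
      (ContMDiffAt.comp p (g := χ) contMDiffAt_extChartAt contMDiffAt_snd)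
  have hκp : κ p = (p.1, χ t) := rfl
  have hικ : ∀ᶠ q in 𝓝 p, ι (κ q) = q := by
    have : ∀ᶠ s in 𝓝 t, s ∈ χ.source := extChartAt_source_mem_nhds t
    filter_upwards [(continuousAt_snd (p := p)).eventually this] with q hq
    exact Prod.ext rfl (χ.left_inv hq)
  have hg' : ContDiffAt ℝ m (fun z => g (ι z)) (h p, χ t) := by
    rw [← contMDiffAt_iff_contDiffAt]
    refine ContMDiffAt.comp (g := g) _ ?_ (hι (h p))
    change ContMDiffAt _ _ _ _ (h p, χ.symm (χ t))
    rwa [hχt]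
  let Γ : EuclideanSpace ℝ (Fin n) × EuclideanSpace ℝ (Fin l) →
      EuclideanSpace ℝ (Fin n) × EuclideanSpace ℝ (Fin l) := fun z => (g (ι z), z.2)
  have hΓ : ContDiffAt ℝ m Γ (h p, χ t) := hg'.prodMk contDiffAt_snd
  obtain ⟨D, hD⟩ : ∃ D, HasFDerivAt (fun z => g (ι z)) D (h p, χ t) :=
    (hg'.differentiableAt hm')
  have hDA : ∀ v, D (v, 0) = A v := by
    intro v
    have h1 : HasFDerivAt (fun v => g (ι (v, χ t)))
        (D ∘L ContinuousLinearMap.inl ℝ _ _) (h p) :=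
      HasFDerivAt.comp (g := fun z => g (ι z)) (h p) hD (hasFDerivAt_prodMk_left (h p) (χ t))
    have h2 : HasFDerivAt (fun v => g (ι (v, χ t)))
        (A : EuclideanSpace ℝ (Fin n) →L[ℝ] EuclideanSpace ℝ (Fin n)) (h p) := by
      change HasFDerivAt (fun v => g (v, χ.symm (χ t))) _ _
      rwa [hχt]
    exact DFunLike.congr_fun (h1.unique h2) v
  let D' : (EuclideanSpace ℝ (Fin n) × EuclideanSpace ℝ (Fin l)) →L[ℝ]
      (EuclideanSpace ℝ (Fin n) × EuclideanSpace ℝ (Fin l)) :=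
    D.prod (ContinuousLinearMap.snd ℝ _ _)
  have hD' : HasFDerivAt Γ D' (h p, χ t) := hD.prodMk hasFDerivAt_snd
  have hinj : Function.Injective (D' : (EuclideanSpace ℝ (Fin n) × EuclideanSpace ℝ (Fin l)) →ₗ[ℝ]
      (EuclideanSpace ℝ (Fin n) × EuclideanSpace ℝ (Fin l))) := by
    rw [injective_iff_map_eq_zero]
    rintro ⟨v, y⟩ hvy
    have hy : y = 0 := congrArg Prod.snd hvy
    subst hy
    have hv : D (v, 0) = 0 := congrArg Prod.fst hvy
    rw [hDA] at hv
    have : v = 0 := by simpa using hv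
    rw [this]
    rfl
  let e := (LinearEquiv.ofInjectiveEndo _ hinj).toContinuousLinearEquiv
  have he : HasFDerivAt Γ (e : (EuclideanSpace ℝ (Fin n) × EuclideanSpace ℝ (Fin l)) →L[ℝ]
      (EuclideanSpace ℝ (Fin n) × EuclideanSpace ℝ (Fin l))) (h p, χ t) :=
    hD'.congr_fderiv (by ext z <;> rfl)
  have hleft := (hΓ.hasStrictFDerivAt' he hm').eventually_left_inverse
  have hloc := hΓ.to_localInverse he hm'
  have hΓp : Γ (h p, χ t) = κ p := by
    refine Prod.ext ?_ rfl
    change g (h p, χ.symm (χ t)) = p.1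
    rw [hχt]
    exact hgh.self_of_nhds
  rw [hΓp] at hloc
  have hHc : ContinuousAt (fun q => (h q, (κ q).2)) p :=
    hc.self_of_nhds.prodMk (continuous_snd.continuousAt.comp hκ.continuousAt)
  have hfin : ContMDiffAt ((𝓡 n).prod (𝓡 l)) (𝓡 n) m
      (fun q => (hΓ.localInverse he hm' (κ q)).1) p :=
    ContMDiffAt.comp (g := Prod.fst) p (contDiff_fst.contMDiff.contMDiffAt)
      (ContMDiffAt.comp p hloc.contMDiffAt hκ)
  refine hfin.congr_of_eventuallyEq ?_
  -- By continuity of `h`, the point `(h q, χ q.2)` lies where the local inverse is a left inverse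
  -- of `Γ`; and `Γ` sends this point to `κ q`.
  filter_upwards [hHc.eventually hleft, hgh, hικ] with q h1 h2 h3
  have h4 : Γ (h q, (κ q).2) = κ q := by
    refine Prod.ext ?_ rfl
    change g (h q, (ι (κ q)).2) = q.1
    rw [h3, h2]
  rw [h4] at h1
  exact (congrArg Prod.fst h1).symm

/-- A bootstrap: `∂h = (∂g(h, ·))⁻¹`, and inversion of linear maps is smooth, so `k` vertical
derivatives of `h` yield `k + 1`. -/
lemma VertAdaptedAt.of_vert_inverse [IsManifold (𝓡 l) m T]
    {g h : EuclideanSpace ℝ (Fin n) × T → EuclideanSpace ℝ (Fin n)}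
    {p : EuclideanSpace ℝ (Fin n) × T} (hg : VertAdaptedAt m (𝓡 l) g (h p, p.2))
    (hinv : (_root_.vertFDeriv g (h p, p.2)).IsInvertible)
    (hc : ∀ᶠ q in 𝓝 p, ContinuousAt h q) (hgh : ∀ᶠ q in 𝓝 p, g (h q, q.2) = q.1) :
    VertAdaptedAt m (𝓡 l) h p := by
  have hH : ContinuousAt (fun q => (h q, q.2)) p :=
    hc.self_of_nhds.prodMk continuous_snd.continuousAt
  have hinv' : ∀ᶠ q in 𝓝 p, (_root_.vertFDeriv g (h q, q.2)).IsInvertible :=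
    hH.eventually (hg.vertFDeriv.continuousAt.eventually hinv.eventually)
  have h0 : ∀ᶠ q in 𝓝 p, ContMDiffAt ((𝓡 n).prod (𝓡 l)) (𝓡 n) m h q := by
    filter_upwards [hinv', hH.eventually (hg 0).eventually_contMDiffAt,
      hH.eventually hg.eventually_hasFDerivAt, eventually_eventually_nhds.2 hc,
      eventually_eventually_nhds.2 hgh] with q ⟨A, hA⟩ h1 h2 h3 h4
    rw [← hA] at h2
    exact contMDiffAt_of_vert_inverse h1 h2 h3 h4
  have h1 : ∀ᶠ q in 𝓝 p, HasFDerivAt (fun v => h (v, q.2))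
      (_root_.vertFDeriv g (h q, q.2)).inverse q.1 := by
    filter_upwards [hinv', hH.eventually hg.eventually_hasFDerivAt, hc,
      eventually_eventually_nhds.2 hgh] with q ⟨A, hA⟩ h2 h3 h4
    rw [← hA] at h2
    rw [← hA, ContinuousLinearMap.inverse_equiv]
    exact HasFDerivAt.of_local_left_inverse (f := fun v => g (v, q.2))
      (ContinuousAt.comp (g := h) (f := fun v => (v, q.2)) h3 (by fun_prop)) h2 (eventually_slice h4)
  intro k
  induction k with
  | zero => exact h0
  | succ k ih =>
    refine ⟨h0, h1.mono fun q hq => hq.differentiableAt, ?_⟩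
    have h2 := ((hg.vertFDeriv k).comp_vert ih).comp_contDiff (φ := ContinuousLinearMap.inverse)
      (hinv.eventually.mono fun B hB => hB.contDiffAt_map_inverse)
    refine h2.congr ?_
    filter_upwards [h1] with q hq using hq.fderiv

/-- A family of maps `ℝⁿ → ℝⁿ` whose derivative is invertible at a point defines a map over the
parameter space which is injective near this point, and open at this point. -/
lemma vert_inverse_function {T : Type*} [TopologicalSpace T]
    {g : EuclideanSpace ℝ (Fin n) × T → EuclideanSpace ℝ (Fin n)}
    {p : EuclideanSpace ℝ (Fin n) × T} (hg : ContinuousAt g p)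
    (hd : ∀ᶠ q in 𝓝 p, HasFDerivAt (fun v => g (v, q.2)) (vertFDeriv g q) q.1)
    (hd' : ContinuousAt (vertFDeriv g) p) (hinv : (vertFDeriv g p).IsInvertible) :
    (∃ u ∈ 𝓝 p, InjOn (fun q => (g q, q.2)) u) ∧
      𝓝 (g p, p.2) ≤ map (fun q => (g q, q.2)) (𝓝 p) := by
  obtain ⟨A, hA⟩ := hinv
  -- The summand `1` keeps `K` positive even when `n = 0`.
  let K : NNReal := ‖(A.symm : EuclideanSpace ℝ (Fin n) →L[ℝ] EuclideanSpace ℝ (Fin n))‖₊ + 1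
  have hK : 0 < K := by positivity
  -- With `K * c = 1/2`, deviating from `A` by at most `c` preserves injectivity and leaves `K⁻¹ - c
  -- > 0` for surjectivity.
  let c : NNReal := K⁻¹ / 2
  have hc : 0 < c := by positivity
  have hAK : ∀ y, ‖A.symm y‖ ≤ K * ‖y‖ := fun y =>
    ((A.symm : EuclideanSpace ℝ (Fin n) →L[ℝ] EuclideanSpace ℝ (Fin n)).le_opNorm y).trans (by
      gcongr
      simp [K])
  have hnear : ∀ᶠ q in 𝓝 p, ‖vertFDeriv g q - A‖ ≤ c := by
    have : ContinuousAt (fun q => ‖vertFDeriv g q - A‖) p := (hd'.sub continuousAt_const).norm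
    refine (this.eventually_lt (g := fun _ => (c : ℝ)) continuousAt_const ?_).mono fun q hq => le_of_lt hq
    rw [← hA]
    simpa using hc
  have hball := hd.and hnear
  rw [← Prod.mk.eta (p := p), nhds_prod_eq] at hball
  obtain ⟨P₁, hP₁, P₂, hP₂, hP⟩ := eventually_prod_iff.1 hball
  obtain ⟨δ, hδ, hδP⟩ := Metric.eventually_nhds_iff_ball.1 hP₁
  -- The linear map, the ball and the constant are the same for all parameters `t`; this uniformity
  -- gives the openness over `T`.
  have happ : ∀ t, P₂ t → ApproximatesLinearOn (fun v => g (v, t))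
      (A : EuclideanSpace ℝ (Fin n) →L[ℝ] EuclideanSpace ℝ (Fin n)) (Metric.ball p.1 δ) c :=
    fun t ht x hx y hy => (convex_ball p.1 δ).norm_image_sub_le_of_norm_hasFDerivWithin_le'
      (f := fun v => g (v, t)) (fun v hv => (hP (hδP v hv) ht).1.hasFDerivWithinAt)
      (fun v hv => (hP (hδP v hv) ht).2) hy hx
  constructor
  · refine ⟨Metric.ball p.1 δ ×ˢ {t | P₂ t}, prod_mem_nhds (Metric.ball_mem_nhds _ hδ) hP₂, ?_⟩
    rintro ⟨x, t⟩ ⟨hx, ht⟩ ⟨y, t'⟩ ⟨hy, -⟩ hxy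
    obtain rfl : t = t' := congrArg Prod.snd hxy
    have hxy' : g (x, t) = g (y, t) := congrArg Prod.fst hxy
    have h1 := happ t ht x hx y hy
    simp only [hxy', sub_self, zero_sub, norm_neg] at h1
    have h2 := hAK (A (x - y))
    rw [A.symm_apply_apply] at h2
    have h3 : ‖x - y‖ ≤ K * (c * ‖x - y‖) := h2.trans (by gcongr; exact h1)
    have h4 : (K : ℝ) * (c * ‖x - y‖) = ‖x - y‖ / 2 := by
      have : (K : ℝ) ≠ 0 := by exact_mod_cast hK.ne'
      simp only [c, NNReal.coe_div, NNReal.coe_inv, NNReal.coe_ofNat]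
      field_simp
    have h5 : ‖x - y‖ = 0 := le_antisymm (by linarith) (norm_nonneg _)
    rw [sub_eq_zero.1 (norm_eq_zero.1 h5)]
  · refine le_map fun s hs => ?_
    rw [← Prod.mk.eta (p := p), mem_nhds_prod_iff] at hs
    obtain ⟨V, hV, W, hW, hVW⟩ := hs
    obtain ⟨ε, hε, hεV⟩ := Metric.nhds_basis_closedBall.mem_iff.1
      (inter_mem hV (Metric.ball_mem_nhds p.1 hδ))
    -- For each `t` the image of the `ε`-ball contains the `r`-ball about `g (p.1, t)`. Half of `r`
    -- is spent on the motion of this centre with `t`.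
    let r : ℝ := ((K : ℝ)⁻¹ - c) * ε
    have hr : 0 < r := by
      have : (0 : ℝ) < (K : ℝ)⁻¹ := by positivity
      have : ((K : ℝ)⁻¹ - c) = (K : ℝ)⁻¹ / 2 := by
        simp only [c, NNReal.coe_div, NNReal.coe_inv, NNReal.coe_ofNat]
        ring
      simp only [r, this]
      positivity
    have hgc : ∀ᶠ t in 𝓝 p.2, g (p.1, t) ∈ Metric.ball (g p) (r / 2) :=
      (ContinuousAt.comp (g := g) (f := fun t => (p.1, t)) hg (by fun_prop)).eventually
        (Metric.ball_mem_nhds _ (by positivity))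
    have hfin : Metric.ball (g p) (r / 2) ×ˢ (W ∩ {t | P₂ t} ∩
        {t | g (p.1, t) ∈ Metric.ball (g p) (r / 2)}) ∈ 𝓝 (g p, p.2) :=
      prod_mem_nhds (Metric.ball_mem_nhds _ (by positivity)) (inter_mem (inter_mem hW hP₂) hgc)
    refine mem_of_superset hfin ?_
    rintro ⟨w, t⟩ ⟨hw, ⟨htW, htP⟩, htr⟩
    have hsurj := (happ t htP).surjOn_closedBall_of_nonlinearRightInverse
      ⟨A.symm, K, hAK, A.apply_symm_apply⟩ hε.le (fun v hv => (hεV hv).2)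
    obtain ⟨v, hv, hvw⟩ := hsurj (show w ∈ Metric.closedBall (g (p.1, t)) r from by
      rw [Metric.mem_closedBall]
      have h1 := dist_triangle_right w (g (p.1, t)) (g p)
      have h2 : dist w (g p) < r / 2 := hw
      have h3 : dist (g (p.1, t)) (g p) < r / 2 := htr
      linarith)
    exact ⟨(v, t), hVW ⟨(hεV hv).1, htW⟩, Prod.ext hvw rfl⟩

end VertInverse

/-! ### Germs of adapted functions and maps on the total space of a family -/

namespace CmFamily

open Filter

section Germs

variable {m : ℕ∞} {n : ℕ}
  {EX HX X : Type*} [NormedAddCommGroup EX] [NormedSpace ℝ EX] [TopologicalSpace HX]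
  {I : ModelWithCorners ℝ EX HX} [TopologicalSpace X] [ChartedSpace HX X]
  {ES HS S : Type*} [NormedAddCommGroup ES] [NormedSpace ℝ ES] [TopologicalSpace HS]
  {J : ModelWithCorners ℝ ES HS} [TopologicalSpace S] [ChartedSpace HS S]
  {α : X → S} {𝓕 : CmFamily m n I J α}
  {G : Type*} [NormedAddCommGroup G] [NormedSpace ℝ G]
  {G' : Type*} [NormedAddCommGroup G'] [NormedSpace ℝ G']
  {Φ : OpenPartialHomeomorph X (EuclideanSpace ℝ (Fin n) × S)} {x : X}

lemma chart_eq_mk (hΦ : Φ ∈ 𝓕.charts) (hx : x ∈ Φ.source) : Φ x = ((Φ x).1, α x) :=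
  Prod.ext rfl (𝓕.over_base Φ hΦ x hx)

/-- The germ of the function `f` at `x` is adapted. -/
def AdaptedAt (𝓕 : CmFamily m n I J α) {G : Type*} [NormedAddCommGroup G] [NormedSpace ℝ G]
    (f : X → G) (x : X) : Prop :=
  ∀ Φ ∈ 𝓕.charts, x ∈ Φ.source → VertAdaptedAt m J (fun p => f (Φ.symm p)) (Φ x)

lemma isOpen_chart_preimage {O : Set X} (hO : IsOpen O) :
    IsOpen (Φ.target ∩ Φ.symm ⁻¹' O) :=
  Φ.symm.isOpen_inter_preimage hO

lemma vertAdaptedAt_change {Φ' : OpenPartialHomeomorph X (EuclideanSpace ℝ (Fin n) × S)}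
    (hΦ : Φ ∈ 𝓕.charts) (hΦ' : Φ' ∈ 𝓕.charts) (hx : x ∈ Φ.source) (hx' : x ∈ Φ'.source) :
    VertAdaptedAt m J (fun p => (Φ' (Φ.symm p)).1) (Φ x) :=
  (𝓕.adapted_change Φ hΦ Φ' hΦ').vertAdaptedAt (isOpen_chart_preimage Φ'.open_source)
    ⟨Φ.map_source hx, by simpa [Φ.left_inv hx] using hx'⟩

lemma eventually_chart (hx : x ∈ Φ.source) {P : X → Prop} (hP : ∀ᶠ y in 𝓝 x, P y) :
    ∀ᶠ p in 𝓝 (Φ x), p ∈ Φ.target ∧ P (Φ.symm p) :=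
  (Φ.open_target.eventually_mem (Φ.map_source hx)).and ((Φ.tendsto_symm hx).eventually hP)

namespace AdaptedAt

variable {f : X → G} {g : X → G'}

/-- A change of charts preserves the parameter and has an adapted vertical component, so `comp_vert`
transports adaptedness to every other chart. -/
lemma of_chart (hΦ : Φ ∈ 𝓕.charts) (hx : x ∈ Φ.source)
    (h : VertAdaptedAt m J (fun p => f (Φ.symm p)) (Φ x)) : 𝓕.AdaptedAt f x := by
  intro Φ' hΦ' hx'
  have h1 : (fun p => (Φ (Φ'.symm p)).1) (Φ' x) = (Φ x).1 := by
    simp only [Φ'.left_inv hx']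
  have h2 : VertAdaptedAt m J (fun p => f (Φ.symm p))
      ((fun p => (Φ (Φ'.symm p)).1) (Φ' x), (Φ' x).2) := by
    rw [h1, 𝓕.over_base Φ' hΦ' x hx', ← chart_eq_mk hΦ hx]
    exact h
  refine (h2.comp_vert (vertAdaptedAt_change hΦ' hΦ hx' hx)).congr ?_
  filter_upwards [eventually_chart hx' (Φ.open_source.eventually_mem hx)] with p ⟨hp, hp'⟩
  have : ((Φ (Φ'.symm p)).1, p.2) = Φ (Φ'.symm p) := by
    rw [chart_eq_mk hΦ hp', 𝓕.apply_symm hΦ' hp]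
  rw [this, Φ.left_inv hp']

lemma congr {f' : X → G} (h : 𝓕.AdaptedAt f x) (hf : f' =ᶠ[𝓝 x] f) : 𝓕.AdaptedAt f' x := by
  intro Φ hΦ hx
  refine (h Φ hΦ hx).congr ?_
  filter_upwards [eventually_chart hx hf] with p hp using hp.2

lemma const (c : G) (x : X) : 𝓕.AdaptedAt (fun _ => c) x :=
  fun _ _ _ => .const _ _

lemma prodMk (hf : 𝓕.AdaptedAt f x) (hg : 𝓕.AdaptedAt g x) :
    𝓕.AdaptedAt (fun y => (f y, g y)) x :=
  fun Φ hΦ hx => (hf Φ hΦ hx).prodMk (hg Φ hΦ hx)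

lemma comp_contDiff (hf : 𝓕.AdaptedAt f x) {φ : G → G'}
    (hφ : ∀ᶠ y in 𝓝 (f x), ContDiffAt ℝ ∞ φ y) : 𝓕.AdaptedAt (fun y => φ (f y)) x := by
  intro Φ hΦ hx
  refine (hf Φ hΦ hx).comp_contDiff ?_
  rwa [Φ.left_inv hx]

lemma chart_fst (hΦ : Φ ∈ 𝓕.charts) (hx : x ∈ Φ.source) : 𝓕.AdaptedAt (fun y => (Φ y).1) x := by
  refine of_chart hΦ hx ((VertAdaptedAt.fst (Φ x)).congr ?_)
  filter_upwards [Φ.open_target.eventually_mem (Φ.map_source hx)] with p hp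
  rw [Φ.right_inv hp]

lemma contMDiffAt (hf : 𝓕.AdaptedAt f x) : ContMDiffAt I 𝓘(ℝ, G) m f x := by
  obtain ⟨Φ, hΦ, hx⟩ := 𝓕.exists_mem_source x
  have h1 : ContMDiffAt I ((𝓡 n).prod J) m Φ x :=
    (𝓕.contMDiffOn_chart Φ hΦ).contMDiffAt (Φ.open_source.mem_nhds hx)
  refine (ContMDiffAt.comp x (hf Φ hΦ hx).contMDiffAt h1).congr_of_eventuallyEq ?_
  filter_upwards [Φ.open_source.eventually_mem hx] with y hy
  simp [Φ.left_inv hy]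

lemma continuousAt (hf : 𝓕.AdaptedAt f x) : ContinuousAt f x :=
  hf.contMDiffAt.continuousAt

lemma adaptedOn {O : Set X} (h : ∀ x ∈ O, 𝓕.AdaptedAt f x) : 𝓕.AdaptedOn f O := by
  refine fun Φ hΦ => VertAdaptedAt.vertAdaptedOn fun p hp => ?_
  have := h _ hp.2 Φ hΦ (Φ.map_target hp.1)
  rwa [Φ.right_inv hp.1] at this

end AdaptedAt

lemma AdaptedOn.adaptedAt {f : X → G} {O : Set X} (h : 𝓕.AdaptedOn f O) (hO : IsOpen O)
    (hx : x ∈ O) : 𝓕.AdaptedAt f x := by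
  refine fun Φ hΦ hxΦ => (h Φ hΦ).vertAdaptedAt (isOpen_chart_preimage hO)
    ⟨Φ.map_source hxΦ, ?_⟩
  simpa [Φ.left_inv hxΦ] using hx

variable {M : Type*} [TopologicalSpace M] [ChartedSpace (EuclideanSpace ℝ (Fin n)) M]
  {q : X → M} {φ : OpenPartialHomeomorph M (EuclideanSpace ℝ (Fin n))}

/-- The germ at `x` of a map from the total space to a `C^∞` manifold is adapted. -/
structure AdaptedMapAt (𝓕 : CmFamily m n I J α) (q : X → M) (x : X) : Prop where
  continuousAt : ContinuousAt q x
  adaptedAt : ∀ φ ∈ atlas (EuclideanSpace ℝ (Fin n)) M, q x ∈ φ.source →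
    𝓕.AdaptedAt (fun y => φ (q y)) x

lemma eventually_contDiffAt_change [IsManifold (𝓡 n) ∞ M]
    {φ' : OpenPartialHomeomorph M (EuclideanSpace ℝ (Fin n))}
    (hφ : φ ∈ atlas (EuclideanSpace ℝ (Fin n)) M) (hφ' : φ' ∈ atlas (EuclideanSpace ℝ (Fin n)) M)
    {y : M} (hy : y ∈ φ.source) (hy' : y ∈ φ'.source) :
    ∀ᶠ v in 𝓝 (φ y), ContDiffAt ℝ ∞ (fun v => φ' (φ.symm v)) v := by
  have hsm : ContDiffOn ℝ ∞ (fun v => φ' (φ.symm v)) (φ.symm ≫ₕ φ').source := by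
    have h := HasGroupoid.compatible (G := contDiffGroupoid ∞ (𝓡 n)) hφ hφ'
    rw [← contMDiffOn_iff_contDiffOn]
    exact contMDiffOn_of_mem_contDiffGroupoid h
  have hopen := (φ.symm ≫ₕ φ').open_source
  filter_upwards [hopen.eventually_mem (x := φ y)
    ⟨φ.map_source hy, by simpa [φ.left_inv hy] using hy'⟩] with v hv
  exact hsm.contDiffAt (hopen.mem_nhds hv)

namespace AdaptedMapAt

lemma of_chart [IsManifold (𝓡 n) ∞ M] (hq : ContinuousAt q x)
    (hφ : φ ∈ atlas (EuclideanSpace ℝ (Fin n)) M) (hx : q x ∈ φ.source)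
    (h : 𝓕.AdaptedAt (fun y => φ (q y)) x) : 𝓕.AdaptedMapAt q x := by
  refine ⟨hq, fun φ' hφ' hx' => ?_⟩
  refine (h.comp_contDiff (eventually_contDiffAt_change hφ hφ' hx hx')).congr ?_
  filter_upwards [hq.eventually (φ.open_source.eventually_mem hx)] with y hy
  simp [φ.left_inv hy]

lemma congr {q' : X → M} (h : 𝓕.AdaptedMapAt q x) (hq : q' =ᶠ[𝓝 x] q) : 𝓕.AdaptedMapAt q' x := by
  refine ⟨h.continuousAt.congr hq.symm, fun φ hφ hx => ?_⟩
  rw [hq.self_of_nhds] at hx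
  refine (h.adaptedAt φ hφ hx).congr ?_
  filter_upwards [hq] with y hy using by rw [hy]

lemma comp (h : 𝓕.AdaptedMapAt q x) (hφ : φ ∈ atlas (EuclideanSpace ℝ (Fin n)) M)
    (hx : q x ∈ φ.source) {c : M → G}
    (hc : ∀ᶠ v in 𝓝 (φ (q x)), ContDiffAt ℝ ∞ (fun v => c (φ.symm v)) v) :
    𝓕.AdaptedAt (fun y => c (q y)) x := by
  refine ((h.adaptedAt φ hφ hx).comp_contDiff hc).congr ?_
  filter_upwards [h.continuousAt.eventually (φ.open_source.eventually_mem hx)] with y hy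
  rw [φ.left_inv hy]

lemma contMDiffAt [IsManifold (𝓡 n) m M] (h : 𝓕.AdaptedMapAt q x) :
    ContMDiffAt I (𝓡 n) m q x := by
  let φ := chartAt (EuclideanSpace ℝ (Fin n)) (q x)
  have hφ : φ ∈ atlas (EuclideanSpace ℝ (Fin n)) M := chart_mem_atlas _ _
  have hx : q x ∈ φ.source := mem_chart_source _ _
  have h1 : ContMDiffAt (𝓡 n) (𝓡 n) m φ.symm (φ (q x)) :=
    (contMDiffOn_symm_of_mem_maximalAtlas
      (IsManifold.subset_maximalAtlas (I := 𝓡 n) (n := m) hφ)).contMDiffAt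
      (φ.open_target.mem_nhds (φ.map_source hx))
  refine (ContMDiffAt.comp x h1 (h.adaptedAt φ hφ hx).contMDiffAt).congr_of_eventuallyEq ?_
  filter_upwards [h.continuousAt.eventually (φ.open_source.eventually_mem hx)] with y hy
  simp [φ.left_inv hy]

end AdaptedMapAt

/-- The map `q` is adapted at `x` and restricts to a local diffeomorphism of the fibre at `x`. -/
structure VertEtaleAt (𝓕 : CmFamily m n I J α) (q : X → M) (x : X) : Prop where
  adaptedMapAt : 𝓕.AdaptedMapAt q x
  exists_isInvertible : ∃ Φ ∈ 𝓕.charts, x ∈ Φ.source ∧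
    ∃ φ ∈ atlas (EuclideanSpace ℝ (Fin n)) M, q x ∈ φ.source ∧
      (vertFDeriv (fun p => φ (q (Φ.symm p))) (Φ x)).IsInvertible

namespace VertEtaleAt

/-- In a fixed pair of charts the vertical derivative is continuous, and invertibility is an open
condition. -/
lemma eventually (h : 𝓕.VertEtaleAt q x) (hq : ∀ᶠ y in 𝓝 x, 𝓕.AdaptedMapAt q y) :
    ∀ᶠ y in 𝓝 x, 𝓕.VertEtaleAt q y := by
  obtain ⟨Φ, hΦ, hx, φ, hφ, hqx, hinv⟩ := h.exists_isInvertible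
  have h1 := (h.adaptedMapAt.adaptedAt φ hφ hqx Φ hΦ hx).vertFDeriv.continuousAt
  filter_upwards [hq, Φ.open_source.eventually_mem hx,
    h.adaptedMapAt.continuousAt.eventually (φ.open_source.eventually_mem hqx),
    (Φ.continuousAt hx).eventually (h1.eventually hinv.eventually)] with y h1 h2 h3 h4
  exact ⟨h1, Φ, hΦ, h2, φ, hφ, h3, h4⟩

lemma inverse_function (h : 𝓕.VertEtaleAt q x) :
    (∃ u ∈ 𝓝 x, InjOn (fun y => (q y, α y)) u) ∧
      𝓝 (q x, α x) ≤ map (fun y => (q y, α y)) (𝓝 x) := by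
  obtain ⟨Φ, hΦ, hx, φ, hφ, hqx, hinv⟩ := h.exists_isInvertible
  have hg := h.adaptedMapAt.adaptedAt φ hφ hqx Φ hΦ hx
  obtain ⟨⟨u, hu, hinj⟩, hopen⟩ := vert_inverse_function hg.continuousAt hg.eventually_hasFDerivAt
    hg.vertFDeriv.continuousAt hinv
  have hφs := h.adaptedMapAt.continuousAt.eventually (φ.open_source.eventually_mem hqx)
  constructor
  · refine ⟨_, inter_mem ((Φ.continuousAt hx) hu) (Φ.open_source.mem_nhds hx), ?_⟩
    rintro y ⟨hyu, hyΦ⟩ z ⟨hzu, hzΦ⟩ hyz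
    refine Φ.injOn hyΦ hzΦ (hinj hyu hzu ?_)
    have h1 : q y = q z := congrArg Prod.fst hyz
    have h2 : α y = α z := congrArg Prod.snd hyz
    refine Prod.ext ?_ ?_
    · simp only [Φ.left_inv hyΦ, Φ.left_inv hzΦ, h1]
    · simp only [𝓕.over_base Φ hΦ y hyΦ, 𝓕.over_base Φ hΦ z hzΦ, h2]
  · refine le_map fun s hs => ?_
    -- Keeping `q` inside `φ.source` lets an equality of `φ`-coordinates be lifted back to `M`.
    have h1 : {p | (p ∈ Φ.target ∧ Φ.symm p ∈ s) ∧ q (Φ.symm p) ∈ φ.source} ∈ 𝓝 (Φ x) :=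
      inter_mem (eventually_chart hx hs) ((eventually_chart hx hφs).mono fun p hp => hp.2)
    have h2 := hopen (image_mem_map h1)
    simp only [Φ.left_inv hx] at h2
    have h3 : Tendsto (fun z : M × S => (φ z.1, z.2)) (𝓝 (q x, α x)) (𝓝 (φ (q x), (Φ x).2)) := by
      rw [𝓕.over_base Φ hΦ x hx]
      have h4 : ContinuousAt (fun z : M × S => φ z.1) (q x, α x) :=
        ContinuousAt.comp (g := φ) (φ.continuousAt hqx) continuousAt_fst
      exact h4.prodMk continuousAt_snd
    have h4 : ∀ᶠ z : M × S in 𝓝 (q x, α x), z.1 ∈ φ.source :=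
      (continuousAt_fst (p := (q x, α x))).eventually (φ.open_source.eventually_mem hqx)
    filter_upwards [h3 h2, h4] with ⟨y, t⟩ ⟨p, ⟨⟨hp, hps⟩, hpφ⟩, hpe⟩ hy
    refine ⟨Φ.symm p, hps, Prod.ext ?_ ?_⟩
    · exact φ.injOn hpφ hy (congrArg Prod.fst hpe)
    · exact (𝓕.apply_symm hΦ hp).trans (congrArg Prod.snd hpe)

end VertEtaleAt

end Germs

end CmFamily

/-! ### Trivialization of a family by a map which is bijective and étale on the fibres -/

namespace CmFamily

open Filter

section Trivialization

variable {m : ℕ∞} {n l : ℕ}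
  {EX HX X : Type*} [NormedAddCommGroup EX] [NormedSpace ℝ EX] [TopologicalSpace HX]
  {I : ModelWithCorners ℝ EX HX} [TopologicalSpace X] [ChartedSpace HX X]
  {T : Type*} [TopologicalSpace T] [ChartedSpace (EuclideanSpace ℝ (Fin l)) T]
  {α : X → T} {𝓕 : CmFamily m n I (𝓡 l) α}
  {M : Type*} [TopologicalSpace M] [ChartedSpace (EuclideanSpace ℝ (Fin n)) M]
  {q : X → M}

/-- The homeomorphism defined by a map which is bijective and étale on the fibres. -/
noncomputable def trivializationHomeomorph (hq : ∀ x, 𝓕.VertEtaleAt q x)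
    (hbij : Function.Bijective fun x => (q x, α x)) : X ≃ₜ M × T :=
  (Equiv.ofBijective _ hbij).toHomeomorphOfContinuousOpen
    (continuous_iff_continuousAt.2 fun x =>
      (hq x).adaptedMapAt.continuousAt.prodMk 𝓕.contMDiff.continuous.continuousAt)
    (isOpenMap_iff_nhds_le.2 fun x => (hq x).inverse_function.2)

lemma isManifold_of_le_infty (m : ℕ∞) [IsManifold (𝓡 n) ∞ M] : IsManifold (𝓡 n) m M :=
  IsManifold.of_le (n := ∞) (by exact_mod_cast le_top)

variable [IsManifold (𝓡 n) ∞ M] [Nonempty M] [IsManifold (𝓡 l) m T]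

/-- In the charts given by étaleness, `Θ` reads `(v, t) ↦ (g(v, t), t)`, and the vertical component
`h` of its inverse is already continuous, so `of_vert_inverse` applies. An adapted change of charts
leads from `Φ₁` to `Φ`. -/
lemma adaptedAt_trivializationHomeomorph_symm (hq : ∀ x, 𝓕.VertEtaleAt q x)
    (hbij : Function.Bijective fun x => (q x, α x)) (y : M × T)
    {Φ : OpenPartialHomeomorph X (EuclideanSpace ℝ (Fin n) × T)} (hΦ : Φ ∈ 𝓕.charts)
    (hy : (trivializationHomeomorph hq hbij).symm y ∈ Φ.source) :
    (CmFamily.prod (n := n) M (𝓡 l) T m).AdaptedAt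
      (fun z => (Φ ((trivializationHomeomorph hq hbij).symm z)).1) y := by
  set Θ := trivializationHomeomorph hq hbij with hΘ
  obtain ⟨x, rfl⟩ := Θ.surjective y
  rw [Θ.symm_apply_apply] at hy
  obtain ⟨Φ₁, hΦ₁, hx₁, φ, hφ, hqx, hinv⟩ := (hq x).exists_isInvertible
  let Ψ := φ.prod (OpenPartialHomeomorph.refl T)
  have hΨ : Ψ ∈ (CmFamily.prod (n := n) M (𝓡 l) T m).charts := ⟨φ, hφ, rfl⟩
  have hxΨ : Θ x ∈ Ψ.source := ⟨hqx, mem_univ _⟩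
  have hΨx : Ψ (Θ x) = (φ (q x), α x) := rfl
  refine AdaptedAt.of_chart hΨ hxΨ ?_
  let h : EuclideanSpace ℝ (Fin n) × T → EuclideanSpace ℝ (Fin n) :=
    fun p => (Φ₁ (Θ.symm (Ψ.symm p))).1
  have hα : ∀ z, α (Θ.symm z) = z.2 := fun z => congrArg Prod.snd (Θ.apply_symm_apply z)
  have hqΘ : ∀ z, q (Θ.symm z) = z.1 := fun z => congrArg Prod.fst (Θ.apply_symm_apply z)
  have hev : ∀ᶠ p in 𝓝 (Ψ (Θ x)), p ∈ Ψ.target ∧ Θ.symm (Ψ.symm p) ∈ Φ₁.source :=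
    eventually_chart hxΨ ((Θ.symm.continuous.tendsto' _ _ (Θ.symm_apply_apply x)).eventually
      (Φ₁.open_source.eventually_mem hx₁))
  have hev' : ∀ᶠ p in 𝓝 (Ψ (Θ x)), (h p, p.2) = Φ₁ (Θ.symm (Ψ.symm p)) := by
    filter_upwards [hev] with p ⟨hp, hp'⟩
    rw [chart_eq_mk hΦ₁ hp', hα]
    rfl
  have hpx : (h (Ψ (Θ x)), (Ψ (Θ x)).2) = Φ₁ x := by
    rw [hev'.self_of_nhds, Ψ.left_inv hxΨ, Θ.symm_apply_apply]
  have hh : VertAdaptedAt m (𝓡 l) h (Ψ (Θ x)) := by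
    refine VertAdaptedAt.of_vert_inverse (g := fun p => φ (q (Φ₁.symm p))) ?_ ?_ ?_ ?_
    · rw [hpx]
      exact (hq x).adaptedMapAt.adaptedAt φ hφ hqx Φ₁ hΦ₁ hx₁
    · rw [hpx]
      exact hinv
    · filter_upwards [hev] with p ⟨hp, hp'⟩
      have h1 : ContinuousAt (fun p => Θ.symm (Ψ.symm p)) p :=
        ContinuousAt.comp (g := Θ.symm) Θ.symm.continuous.continuousAt (Ψ.symm.continuousAt hp)
      have h2 : ContinuousAt (fun p => Φ₁ (Θ.symm (Ψ.symm p))) p :=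
        ContinuousAt.comp (g := Φ₁) (Φ₁.continuousAt hp') h1
      exact h2.fst
    · filter_upwards [hev, hev'] with p ⟨hp, hp'⟩ hp''
      simp only [hp'', Φ₁.left_inv hp', hqΘ]
      exact φ.right_inv hp.1
  have hchange : VertAdaptedAt m (𝓡 l) (fun p => (Φ (Φ₁.symm p)).1)
      (h (Ψ (Θ x)), (Ψ (Θ x)).2) := by
    rw [hpx]
    exact vertAdaptedAt_change hΦ₁ hΦ hx₁ hy
  refine (hchange.comp_vert hh).congr ?_
  filter_upwards [hev, hev'] with p ⟨hp, hp'⟩ hp''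
  simp only [hp'', Φ₁.left_inv hp']

/-- The isomorphism with a product family defined by a map which is bijective and étale on the
fibres. -/
noncomputable def isoOfVertEtale (hq : ∀ x, 𝓕.VertEtaleAt q x)
    (hbij : Function.Bijective fun x => (q x, α x)) : 𝓕.Iso (CmFamily.prod (n := n) M (𝓡 l) T m) where
  toHomeomorph := trivializationHomeomorph hq hbij
  isMorphism := by
    have := isManifold_of_le_infty (n := n) (M := M) m
    refine ⟨fun x => rfl, ?_, contMDiff_id, ?_⟩
    · exact ContMDiff.prodMk (fun x => (hq x).adaptedMapAt.contMDiffAt) 𝓕.contMDiff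
    · rintro _ ⟨φ, hφ, rfl⟩
      exact AdaptedAt.adaptedOn fun x hx => (hq x).adaptedMapAt.adaptedAt φ hφ hx.1
  isMorphism_symm := by
    set Θ := trivializationHomeomorph hq hbij with hΘ
    have hα : ∀ z, α (Θ.symm z) = z.2 := fun z => congrArg Prod.snd (Θ.apply_symm_apply z)
    refine ⟨hα, fun y => ?_, contMDiff_id, fun Φ hΦ => AdaptedAt.adaptedOn fun y hy =>
      adaptedAt_trivializationHomeomorph_symm hq hbij y hΦ hy⟩
    obtain ⟨Φ, hΦ, hy⟩ := 𝓕.exists_mem_source (Θ.symm y)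
    have h1 : ContMDiffAt ((𝓡 n).prod (𝓡 l)) (𝓡 n) m (fun z => (Φ (Θ.symm z)).1) y :=
      (adaptedAt_trivializationHomeomorph_symm hq hbij y hΦ hy).contMDiffAt
    have hev : ∀ᶠ z in 𝓝 y, Θ.symm z ∈ Φ.source :=
      Θ.symm.continuous.continuousAt.eventually (Φ.open_source.eventually_mem hy)
    -- This recovers the inverse from its adapted vertical coordinate and the parameter.
    have heq : ∀ᶠ z in 𝓝 y, Θ.symm z = Φ.symm ((Φ (Θ.symm z)).1, z.2) := by
      filter_upwards [hev] with z hz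
      rw [← hα z, ← chart_eq_mk hΦ hz, Φ.left_inv hz]
    have h2 : ContMDiffAt ((𝓡 n).prod (𝓡 l)) I m Φ.symm ((Φ (Θ.symm y)).1, y.2) := by
      have : ((Φ (Θ.symm y)).1, y.2) ∈ Φ.target := by
        rw [← hα y, ← chart_eq_mk hΦ hy]
        exact Φ.map_source hy
      exact (𝓕.contMDiffOn_chart_symm Φ hΦ).contMDiffAt (Φ.open_target.mem_nhds this)
    exact (ContMDiffAt.comp y h2 (h1.prodMk contMDiffAt_snd)).congr_of_eventuallyEq heq

end Trivialization

end CmFamily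

/-! ### Adapted retractions to a fibre -/

namespace CmFamily

open Filter

section Retraction

variable {m : ℕ∞} {n l : ℕ}
  {EX HX X : Type*} [NormedAddCommGroup EX] [NormedSpace ℝ EX] [TopologicalSpace HX]
  {I : ModelWithCorners ℝ EX HX} [TopologicalSpace X] [ChartedSpace HX X]
  {S : Type*} [TopologicalSpace S] [ChartedSpace (EuclideanSpace ℝ (Fin l)) S]
  {α : X → S} {𝓕 : CmFamily m n I (𝓡 l) α}

/-- Adapted cutoff functions. -/
lemma exists_cutoff [T2Space X] (𝓕 : CmFamily m n I (𝓡 l) α) {x₀ : X} {O : Set X}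
    (hO : O ∈ 𝓝 x₀) :
    ∃ (ψ : X → ℝ) (C : Set X), IsClosed C ∧ C ⊆ O ∧ (∀ x, 0 ≤ ψ x) ∧ (∀ x ∉ C, ψ x = 0) ∧
      (∀ᶠ x in 𝓝 x₀, ψ x = 1) ∧ ∃ W ∈ 𝓝 (α x₀), IsOpen W ∧ ∀ x, α x ∈ W → 𝓕.AdaptedAt ψ x := by
  classical
  have : LocallyCompactSpace S := ChartedSpace.locallyCompactSpace (EuclideanSpace ℝ (Fin l)) S
  obtain ⟨Φ, hΦ, hx⟩ := 𝓕.exists_mem_source x₀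
  have h1 := eventually_chart hx hO
  rw [chart_eq_mk hΦ hx] at h1
  obtain ⟨V, hV, W, hW, hVW⟩ := mem_nhds_prod_iff.1 h1
  obtain ⟨ρ, hρ, hρV⟩ := Metric.nhds_basis_closedBall.mem_iff.1 hV
  obtain ⟨K, hK, hKW, hKc⟩ := local_compact_nhds hW
  let b : ContDiffBump (Φ x₀).1 := ⟨ρ / 2, ρ, by positivity, by linarith⟩
  let B : Set (EuclideanSpace ℝ (Fin n) × S) := Metric.closedBall (Φ x₀).1 ρ ×ˢ K
  have hB : ∀ p ∈ B, p ∈ Φ.target ∧ Φ.symm p ∈ O := fun p hp => hVW ⟨hρV hp.1, hKW hp.2⟩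
  -- `C` is compact, hence closed in the Hausdorff space `X`, so extension by zero outside the chart
  -- is harmless.
  let C : Set X := Φ.symm '' B
  have hCc : IsCompact C :=
    ((isCompact_closedBall _ _).prod hKc).image_of_continuousOn
      (Φ.symm.continuousOn.mono fun p hp => (hB p hp).1)
  have hmem : ∀ x ∈ Φ.source, α x ∈ K → (Φ x).1 ∈ Metric.closedBall (Φ x₀).1 ρ → x ∈ C := by
    intro x hxΦ hxK hxb
    refine ⟨Φ x, ⟨hxb, ?_⟩, Φ.left_inv hxΦ⟩
    rwa [𝓕.over_base Φ hΦ x hxΦ]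
  have hCΦ : C ⊆ Φ.source := by
    rintro _ ⟨p, hp, rfl⟩
    exact Φ.map_target (hB p hp).1
  -- There is no cutoff in the base direction: `ψ` may jump over the boundary of `K`, and
  -- adaptedness is claimed only over its interior.
  let ψ : X → ℝ := fun x => if x ∈ C then b (Φ x).1 else 0
  have hψ : ∀ x ∈ Φ.source, α x ∈ K → ψ x = b (Φ x).1 := by
    intro x hxΦ hxK
    by_cases hxC : x ∈ C
    · exact if_pos hxC
    · simp only [ψ, if_neg hxC]
      refine (b.zero_of_le_dist ?_).symm
      by_contra! hlt
      exact hxC (hmem x hxΦ hxK (Metric.mem_closedBall.2 hlt.le))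
  have hαc := 𝓕.contMDiff.continuous
  have hαK : ∀ x, α x ∈ interior K → ∀ᶠ z in 𝓝 x, α z ∈ K := fun x hxK =>
    (hαc.continuousAt.eventually (isOpen_interior.eventually_mem hxK)).mono
      fun z hz => interior_subset hz
  have hx₀K : α x₀ ∈ interior K := mem_interior_iff_mem_nhds.2 hK
  refine ⟨ψ, C, hCc.isClosed, ?_, fun x => ?_, fun x hxC => if_neg hxC, ?_,
    interior K, interior_mem_nhds.2 hK, isOpen_interior, fun x hxK => ?_⟩
  · rintro _ ⟨p, hp, rfl⟩
    exact (hB p hp).2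
  · by_cases hxC : x ∈ C
    · simpa only [ψ, if_pos hxC] using b.nonneg
    · simp [ψ, if_neg hxC]
  · filter_upwards [Φ.open_source.eventually_mem hx, hαK x₀ hx₀K,
      ((Φ.continuousAt hx).fst).eventually b.eventuallyEq_one] with z hz hzK hzb
    rw [hψ z hz hzK]
    exact hzb
  · by_cases hxΦ : x ∈ Φ.source
    · refine ((AdaptedAt.chart_fst hΦ hxΦ).comp_contDiff
        (Eventually.of_forall fun v => b.contDiffAt)).congr ?_
      filter_upwards [Φ.open_source.eventually_mem hxΦ, hαK x hxK] with z hz hzK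
      exact hψ z hz hzK
    · refine (AdaptedAt.const (0 : ℝ) x).congr ?_
      filter_upwards [hCc.isClosed.isOpen_compl.eventually_mem fun h => hxΦ (hCΦ h)] with z hz
      exact if_neg hz

lemma AdaptedMapAt.of_symm {M : Type*} [TopologicalSpace M]
    [ChartedSpace (EuclideanSpace ℝ (Fin n)) M] [IsManifold (𝓡 n) ∞ M]
    {φ : OpenPartialHomeomorph M (EuclideanSpace ℝ (Fin n))}
    (hφ : φ ∈ atlas (EuclideanSpace ℝ (Fin n)) M) {F : X → EuclideanSpace ℝ (Fin n)} {x : X}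
    (hF : 𝓕.AdaptedAt F x) (hx : F x ∈ φ.target) {q : X → M}
    (hq : q =ᶠ[𝓝 x] fun z => φ.symm (F z)) : 𝓕.AdaptedMapAt q x := by
  refine AdaptedMapAt.congr (of_chart (φ := φ) ?_ hφ (φ.map_target hx) (hF.congr ?_)) hq
  · exact ContinuousAt.comp (g := φ.symm) (φ.symm.continuousAt hx) hF.continuousAt
  · filter_upwards [hF.continuousAt.eventually (φ.open_target.eventually_mem hx)] with z hz
    exact φ.right_inv hz

/-- The map `q` is, near `x`, an adapted retraction to the fibre. -/
structure RetractsAt (𝓕 : CmFamily m n I (𝓡 l) α) {s₀ : S} (q : X → 𝓕.Fiber s₀) (x : X) :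
    Prop where
  adapted : ∀ᶠ z in 𝓝 x, 𝓕.AdaptedMapAt q z
  eq_self : ∀ᶠ z in 𝓝 x, ∀ h : α z = s₀, q z = ⟨z, h⟩

lemma fiberChart_mem_atlas (𝓕 : CmFamily m n I (𝓡 l) α) (s₀ : S)
    {Φ : OpenPartialHomeomorph X (EuclideanSpace ℝ (Fin n) × S)} (hΦ : Φ ∈ 𝓕.charts) :
    𝓕.fiberChart s₀ Φ hΦ ∈ atlas (EuclideanSpace ℝ (Fin n)) (𝓕.Fiber s₀) :=
  ⟨Φ, hΦ, rfl⟩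

/-- The form taken by the glued retractions inside a chart. Since `F x` lies in the open target of
the fibre chart, so does `F` near `x`. -/
lemma RetractsAt.of_symm {s₀ : S} {q : X → 𝓕.Fiber s₀} {x : X} (hx : α x = s₀)
    {Φ : OpenPartialHomeomorph X (EuclideanSpace ℝ (Fin n) × S)} (hΦ : Φ ∈ 𝓕.charts)
    (hxΦ : x ∈ Φ.source) {F : X → EuclideanSpace ℝ (Fin n)} (hF : ∀ᶠ z in 𝓝 x, 𝓕.AdaptedAt F z)
    (hFs : ∀ᶠ z in 𝓝 x, α z = s₀ → F z = (Φ z).1)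
    (hq : ∀ᶠ z in 𝓝 x, q z = (𝓕.fiberChart s₀ Φ hΦ).symm (F z)) : 𝓕.RetractsAt q x := by
  set φ := 𝓕.fiberChart s₀ Φ hΦ with hφ_def
  have hφ : φ ∈ atlas (EuclideanSpace ℝ (Fin n)) (𝓕.Fiber s₀) := fiberChart_mem_atlas 𝓕 s₀ hΦ
  have hFx : F x ∈ φ.target := by
    rw [hFs.self_of_nhds hx]
    exact φ.map_source (x := ⟨x, hx⟩) hxΦ
  constructor
  · filter_upwards [hF, hF.self_of_nhds.continuousAt.eventually (φ.open_target.eventually_mem hFx),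
      eventually_eventually_nhds.2 hq] with z h1 h2 h3
    exact .of_symm hφ h1 h2 h3
  · filter_upwards [hFs, hq, Φ.open_source.eventually_mem hxΦ] with z h1 h2 h3 hz
    rw [h2, h1 hz]
    exact φ.left_inv (x := ⟨z, hz⟩) h3

/-- The gluing step: the region where `q` is good is enlarged by `N`. That `N` does not depend on
`q` allows a finite cover to be fixed before the retraction is built. -/
lemma exists_extend_retraction [T2Space X] (𝓕 : CmFamily m n I (𝓡 l) α) (s₀ : S) (x₀ : X)
    (hx₀ : α x₀ = s₀) : ∃ N ∈ 𝓝 x₀, ∀ q : X → 𝓕.Fiber s₀, ∃ q' : X → 𝓕.Fiber s₀,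
      ∀ x, α x = s₀ → 𝓕.RetractsAt q x ∨ x ∈ N → 𝓕.RetractsAt q' x := by
  classical
  obtain ⟨Φ, hΦ, hx₀Φ⟩ := 𝓕.exists_mem_source x₀
  obtain ⟨ψ, C, hC, hCΦ, -, hψ0, hψ1, W, hW, hWo, hψW⟩ :=
    𝓕.exists_cutoff (Φ.open_source.mem_nhds hx₀Φ)
  rw [hx₀] at hW
  set φ := 𝓕.fiberChart s₀ Φ hΦ with hφ_def
  have hφ : φ ∈ atlas (EuclideanSpace ℝ (Fin n)) (𝓕.Fiber s₀) := fiberChart_mem_atlas 𝓕 s₀ hΦ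
  have hψA : ∀ x, α x = s₀ → ∀ᶠ z in 𝓝 x, 𝓕.AdaptedAt ψ z := fun x hx => by
    have h1 : α x ∈ W := by
      rw [hx]
      exact mem_of_mem_nhds hW
    exact (𝓕.contMDiff.continuous.continuousAt.eventually (hWo.eventually_mem h1)).mono
      fun z hz => hψW z hz
  refine ⟨_, eventually_eventually_nhds.2 hψ1, fun q => ?_⟩
  -- On `X_{s₀}`, where `q` is already a retraction, both terms equal `Φ₁`; so `F` has values in the
  -- target of `φ` near there, without any convexity.
  let F : X → EuclideanSpace ℝ (Fin n) := fun x => (1 - ψ x) • φ (q x) + ψ x • (Φ x).1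
  refine ⟨fun x => if x ∈ C then φ.symm (F x) else q x, fun x hx h => ?_⟩
  by_cases hN : ∀ᶠ z in 𝓝 x, ψ z = 1
  -- Near `x` only the term `Φ₁` survives, so nothing is asked of `q`.
  · have hCx : ∀ᶠ z in 𝓝 x, z ∈ C := by
      filter_upwards [hN] with z hz
      by_contra hzC
      rw [hψ0 z hzC] at hz
      exact zero_ne_one hz
    have hxΦ : x ∈ Φ.source := hCΦ hCx.self_of_nhds
    refine RetractsAt.of_symm hx hΦ hxΦ (F := fun z => (Φ z).1) ?_
      (Eventually.of_forall fun _ _ => rfl) ?_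
    · filter_upwards [Φ.open_source.eventually_mem hxΦ] with z hz
      exact AdaptedAt.chart_fst hΦ hz
    · filter_upwards [hCx, hN] with z h1 h2
      simp [if_pos h1, F, h2, φ]
  · have hq : 𝓕.RetractsAt q x := h.resolve_right hN
    -- At a point of `C` the formula `φ.symm (F z)` is valid on a full neighbourhood: off `C` the
    -- weight vanishes and it returns `q z`. Off the closed set `C` nothing changes.
    by_cases hxC : x ∈ C
    · have hxΦ : x ∈ Φ.source := hCΦ hxC
      have hqx : q x ∈ φ.source := by
        rw [hq.eq_self.self_of_nhds hx]
        exact hxΦ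
      have hqφ : ∀ᶠ z in 𝓝 x, q z ∈ φ.source :=
        hq.adapted.self_of_nhds.continuousAt.eventually (φ.open_source.eventually_mem hqx)
      refine RetractsAt.of_symm hx hΦ hxΦ (F := F) ?_ ?_ ?_
      · filter_upwards [hq.adapted, hqφ, hψA x hx, Φ.open_source.eventually_mem hxΦ]
          with z h1 h2 h3 h4
        exact (h3.prodMk ((h1.adaptedAt φ hφ h2).prodMk (AdaptedAt.chart_fst hΦ h4))).comp_contDiff
          (φ := fun a : ℝ × EuclideanSpace ℝ (Fin n) × EuclideanSpace ℝ (Fin n) =>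
            (1 - a.1) • a.2.1 + a.1 • a.2.2) (Eventually.of_forall fun a => by fun_prop)
      · filter_upwards [hq.eq_self] with z h1 hz
        have : φ (q z) = (Φ z).1 := by
          rw [h1 hz]
          rfl
        simp only [F, this, ← add_smul, sub_add_cancel, one_smul]
      · filter_upwards [hqφ] with z h1
        by_cases hzC : z ∈ C
        · rw [if_pos hzC]
        · rw [if_neg hzC]
          simp only [F, hψ0 z hzC, sub_zero, one_smul, zero_smul, add_zero]
          exact (φ.left_inv h1).symm
    · have heq : ∀ᶠ z in 𝓝 x, (if z ∈ C then φ.symm (F z) else q z) = q z := by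
        filter_upwards [hC.isOpen_compl.eventually_mem hxC] with z hz
        exact if_neg hz
      constructor
      · filter_upwards [hq.adapted, eventually_eventually_nhds.2 heq] with z h1 h2
        exact h1.congr h2
      · filter_upwards [hq.eq_self, heq] with z h1 h2 hz
        exact h2.trans (h1 hz)

/-- A family of compact manifolds has an adapted retraction to each of its fibres. -/
lemma exists_retraction [T2Space X] [T1Space S] (𝓕 : CmFamily m n I (𝓡 l) α) (hα : IsProperMap α)
    (s₀ : S) : ∃ q : X → 𝓕.Fiber s₀, ∀ x, α x = s₀ → 𝓕.RetractsAt q x := by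
  classical
  choose! N hN hext using fun x hx => 𝓕.exists_extend_retraction s₀ x hx
  have hK : IsCompact (α ⁻¹' {s₀}) := hα.isCompact_preimage isCompact_singleton
  obtain ⟨t, ht, htN⟩ := hK.elim_nhds_subcover N hN
  -- The induction starts from an arbitrary constant map, about which the empty union claims
  -- nothing.
  have key : ∀ t : Finset X, (∀ x ∈ t, α x = s₀) → ∃ q : X → 𝓕.Fiber s₀, ∀ x, α x = s₀ →
      x ∈ ⋃ y ∈ t, N y → 𝓕.RetractsAt q x := by
    intro t
    induction t using Finset.induction_on with
    | empty => exact fun _ => ⟨fun _ => Classical.arbitrary _, fun x _ hx => by simp at hx⟩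
    | insert a t ha ih =>
      intro hat
      obtain ⟨q, hq⟩ := ih fun x hx => hat x (Finset.mem_insert_of_mem hx)
      obtain ⟨q', hq'⟩ := hext a (hat a (Finset.mem_insert_self a t)) q
      refine ⟨q', fun x hx hxt => hq' x hx ?_⟩
      rw [Finset.set_biUnion_insert] at hxt
      exact hxt.elim Or.inr fun h => Or.inl (hq x hx h)
  obtain ⟨q, hq⟩ := key t ht
  exact ⟨q, fun x hx => hq x hx (htN hx)⟩

/-- On the slice over `s₀`, in a chart and its restriction to the fibre, `q` is the identity, and so
is its vertical derivative. -/
lemma RetractsAt.vertEtaleAt {s₀ : S} {q : X → 𝓕.Fiber s₀} {x : X} (h : 𝓕.RetractsAt q x)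
    (hx : α x = s₀) : 𝓕.VertEtaleAt q x := by
  obtain ⟨Φ, hΦ, hxΦ⟩ := 𝓕.exists_mem_source x
  set φ := 𝓕.fiberChart s₀ Φ hΦ with hφ_def
  refine ⟨h.adapted.self_of_nhds, Φ, hΦ, hxΦ, φ, fiberChart_mem_atlas 𝓕 s₀ hΦ, ?_, ?_⟩
  · rw [h.eq_self.self_of_nhds hx]
    exact hxΦ
  · have hs : (Φ x).2 = s₀ := (𝓕.over_base Φ hΦ x hxΦ).trans hx
    have h1 : (fun v => φ (q (Φ.symm (v, (Φ x).2)))) =ᶠ[𝓝 (Φ x).1] fun v => v := by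
      filter_upwards [eventually_slice (eventually_chart hxΦ h.eq_self)] with v ⟨hv, hv'⟩
      have h2 : α (Φ.symm (v, (Φ x).2)) = s₀ := (𝓕.apply_symm hΦ hv).trans hs
      rw [hv' h2]
      exact congrArg Prod.fst (Φ.right_inv hv)
    have h2 : vertFDeriv (fun p => φ (q (Φ.symm p))) (Φ x) = ContinuousLinearMap.id ℝ _ :=
      h1.fderiv_eq.trans fderiv_fun_id
    rw [h2]
    exact ⟨ContinuousLinearEquiv.refl ℝ _, rfl⟩

instance [T2Space X] (s : S) : T2Space (𝓕.Fiber s) :=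
  T2Space.of_injective_continuous (f := 𝓕.fiberIncl s) (fun _ _ h => Fiber.ext h)
    (𝓕.fiberIncl s).continuous

lemma compactSpace_fiber [T1Space S] (hα : IsProperMap α) (s : S) : CompactSpace (𝓕.Fiber s) := by
  have hind : Topology.IsInducing (𝓕.fiberIncl s) := ⟨rfl⟩
  rw [← isCompact_univ_iff, hind.isCompact_iff]
  convert! hα.isCompact_preimage (isCompact_singleton (x := s)) using 1
  ext x
  exact ⟨fun ⟨y, _, hy⟩ => hy ▸ y.property, fun hx => ⟨⟨x, hx⟩, mem_univ _, rfl⟩⟩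

/-- A proper map is closed, so every neighbourhood of a fibre contains all nearby fibres. -/
lemma eventually_forall_fiber (hα : IsProperMap α) {s₀ : S} {P : X → Prop}
    (h : ∀ x, α x = s₀ → ∀ᶠ z in 𝓝 x, P z) : ∀ᶠ s in 𝓝 s₀, ∀ x, α x = s → P x :=
  hα.isClosedMap.eventually_nhds_fiber s₀ h

/-- A family of compact manifolds is trivialized near a fibre by an adapted retraction. -/
lemma exists_trivializing_retraction [T2Space X] [T2Space S] (𝓕 : CmFamily m n I (𝓡 l) α)
    (hα : IsProperMap α) (s₀ : S) : ∃ q : X → 𝓕.Fiber s₀, (∀ x (h : α x = s₀), q x = ⟨x, h⟩) ∧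
      ∀ᶠ s in 𝓝 s₀, (∀ x, α x = s → 𝓕.VertEtaleAt q x) ∧
        ∀ y, ∃! x, α x = s ∧ q x = y := by
  obtain ⟨q, hq⟩ := 𝓕.exists_retraction hα s₀
  have hqs : ∀ x (h : α x = s₀), q x = ⟨x, h⟩ := fun x h => (hq x h).eq_self.self_of_nhds h
  refine ⟨q, hqs, ?_⟩
  have hα' := 𝓕.contMDiff.continuous
  have hcomp : CompactSpace (𝓕.Fiber s₀) := compactSpace_fiber hα s₀
  have h1 : ∀ᶠ s in 𝓝 s₀, ∀ x, α x = s → 𝓕.VertEtaleAt q x :=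
    eventually_forall_fiber hα fun x hx => ((hq x hx).vertEtaleAt hx).eventually (hq x hx).adapted
  -- A map injective on a compact set and locally injective at its points is injective on a
  -- neighbourhood of that set.
  obtain ⟨t, ht, hinj⟩ := Set.InjOn.exists_mem_nhdsSet (f := fun x => (q x, α x))
    (s := α ⁻¹' {s₀}) (fun x hx y hy hxy => by
      have h2 := congrArg (fun z => z.1.val) hxy
      simp only [hqs x hx, hqs y hy] at h2
      exact h2)
    (hα.isCompact_preimage isCompact_singleton)
    (fun x hx => (hq x hx).adapted.self_of_nhds.continuousAt.prodMk hα'.continuousAt)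
    (fun x hx => ((hq x hx).vertEtaleAt hx).inverse_function.1)
  have h2 : ∀ᶠ s in 𝓝 s₀, ∀ x, α x = s → x ∈ t :=
    eventually_forall_fiber hα fun x hx => mem_nhdsSet_iff_forall.1 ht x hx
  -- The image of `(q, α)` is a neighbourhood of each `(y, s₀)`; compactness of `X_{s₀}` makes the
  -- range of parameters uniform in `y`.
  have h3 : ∀ᶠ s in 𝓝 s₀, ∀ y ∈ (univ : Set (𝓕.Fiber s₀)), ∃ x, α x = s ∧ q x = y := by
    refine isCompact_univ.eventually_forall_of_forall_eventually fun y _ => ?_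
    have h4 := ((hq y.1 y.2).vertEtaleAt y.2).inverse_function.2 (image_mem_map univ_mem)
    rw [hqs y.1 y.2, y.2] at h4
    have h5 : Tendsto (fun z : S × 𝓕.Fiber s₀ => (z.2, z.1)) (𝓝 (s₀, y)) (𝓝 (y, s₀)) :=
      continuous_swap.tendsto _
    filter_upwards [h5 h4] with z ⟨x, _, hx⟩
    exact ⟨x, congrArg Prod.snd hx, congrArg Prod.fst hx⟩
  filter_upwards [h1, h2, h3] with s hs1 hs2 hs3
  refine ⟨hs1, fun y => ?_⟩
  obtain ⟨x, hx, hxy⟩ := hs3 y (mem_univ y)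
  refine ⟨x, ⟨hx, hxy⟩, fun z ⟨hz, hzy⟩ => ?_⟩
  exact hinj (hs2 z hz) (hs2 x hx) (Prod.ext (hzy.trans hxy.symm) (hz.trans hx.symm))

end Retraction

end CmFamily

/-! ### Restriction of adapted germs to an open subset of the base -/

namespace CmFamily

open Filter

section Restriction

variable {m : ℕ∞} {n : ℕ}
  {EX HX X : Type*} [NormedAddCommGroup EX] [NormedSpace ℝ EX] [TopologicalSpace HX]
  {I : ModelWithCorners ℝ EX HX} [TopologicalSpace X] [ChartedSpace HX X]
  {ES HS S : Type*} [NormedAddCommGroup ES] [NormedSpace ℝ ES] [TopologicalSpace HS]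
  {J : ModelWithCorners ℝ ES HS} [TopologicalSpace S] [ChartedSpace HS S]
  {α : X → S} {𝓕 : CmFamily m n I J α} {U : Opens S} {x : 𝓕.preim U}
  {Φ : OpenPartialHomeomorph X (EuclideanSpace ℝ (Fin n) × S)}

lemma restrictChart_apply_coe (hΦ : Φ ∈ 𝓕.charts) (hx : x.1 ∈ Φ.source) :
    ((𝓕.restrictChart U Φ hΦ x).1, (𝓕.restrictChart U Φ hΦ x).2.1) = Φ x.1 :=
  (chart_eq_mk hΦ hx).symm

lemma eventually_restrictChart_symm (hΦ : Φ ∈ 𝓕.charts) (hx : x.1 ∈ Φ.source) {Y : Type*}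
    (f : X → Y) :
    (fun p => f ((𝓕.restrictChart U Φ hΦ).symm p).1) =ᶠ[𝓝 (𝓕.restrictChart U Φ hΦ x)]
      fun p => f (Φ.symm (p.1, p.2.1)) := by
  have h1 : 𝓕.restrictChart U Φ hΦ x ∈ (𝓕.restrictChart U Φ hΦ).target :=
    (𝓕.restrictChart U Φ hΦ).map_source hx
  filter_upwards [(𝓕.restrictChart U Φ hΦ).open_target.eventually_mem h1] with p hp
  rw [𝓕.restrictChart_symm_val U Φ hΦ hp]

/-- In restricted charts this is a change of parameter along the inclusion of `U` in `S`. -/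
lemma AdaptedAt.restrict {G : Type*} [NormedAddCommGroup G] [NormedSpace ℝ G] {f : X → G}
    (h : 𝓕.AdaptedAt f x.1) :
    (𝓕.restrict U).AdaptedAt (fun y => f y.1) x := by
  obtain ⟨Φ, hΦ, hx⟩ := 𝓕.exists_mem_source x.1
  refine AdaptedAt.of_chart (𝓕 := 𝓕.restrict U) (Φ := 𝓕.restrictChart U Φ hΦ) ⟨Φ, hΦ, rfl⟩ hx ?_
  refine VertAdaptedAt.congr ?_ (eventually_restrictChart_symm hΦ hx f)
  refine VertAdaptedAt.comp_base (f := fun p => f (Φ.symm p)) (contMDiff_subtype_val (I := J)) ?_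
  rw [restrictChart_apply_coe hΦ hx]
  exact h Φ hΦ hx

variable {M : Type*} [TopologicalSpace M] [ChartedSpace (EuclideanSpace ℝ (Fin n)) M] {q : X → M}

lemma AdaptedMapAt.restrict (h : 𝓕.AdaptedMapAt q x.1) :
    (𝓕.restrict U).AdaptedMapAt (fun y => q y.1) x :=
  ⟨ContinuousAt.comp (g := q) h.continuousAt continuous_subtype_val.continuousAt,
    fun φ hφ hx => (h.adaptedAt φ hφ hx).restrict⟩

lemma VertEtaleAt.restrict (h : 𝓕.VertEtaleAt q x.1) :
    (𝓕.restrict U).VertEtaleAt (fun y => q y.1) x := by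
  obtain ⟨Φ, hΦ, hx, φ, hφ, hqx, hinv⟩ := h.exists_isInvertible
  refine ⟨h.adaptedMapAt.restrict, 𝓕.restrictChart U Φ hΦ, ⟨Φ, hΦ, rfl⟩, hx, φ, hφ, hqx, ?_⟩
  rw [(vertFDeriv_congr (eventually_restrictChart_symm hΦ hx fun y => φ (q y))).self_of_nhds]
  change (vertFDeriv (fun p => φ (q (Φ.symm p))) ((𝓕.restrictChart U Φ hΦ x).1,
    (𝓕.restrictChart U Φ hΦ x).2.1)).IsInvertible
  rwa [restrictChart_apply_coe hΦ hx]

end Restriction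

end CmFamily

/-! ### Trivialization of families of vector bundles -/

section Trivializations

variable {B 𝕜 F : Type*} [RCLike 𝕜] [NormedAddCommGroup F] [NormedSpace 𝕜 F] [TopologicalSpace B]
  {E : B → Type*} [TopologicalSpace (TotalSpace F E)]
  [∀ x, AddCommMonoid (E x)] [∀ x, Module 𝕜 (E x)] [∀ x, TopologicalSpace (E x)]
  [FiberBundle F E]

lemma Bundle.Trivialization.coordChangeL_coordChangeL (e e' e'' : Trivialization F (π F E))
    [e.IsLinear 𝕜] [e'.IsLinear 𝕜] [e''.IsLinear 𝕜] {b : B} (h : b ∈ e.baseSet)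
    (h' : b ∈ e'.baseSet) (h'' : b ∈ e''.baseSet) (v : F) :
    e'.coordChangeL 𝕜 e'' b (e.coordChangeL 𝕜 e' b v) = e.coordChangeL 𝕜 e'' b v := by
  rw [← comp_continuousLinearEquivAt_eq_coord_change e e' ⟨h, h'⟩,
    ← comp_continuousLinearEquivAt_eq_coord_change e' e'' ⟨h', h''⟩,
    ← comp_continuousLinearEquivAt_eq_coord_change e e'' ⟨h, h''⟩]
  simp only [ContinuousLinearEquiv.trans_apply, ContinuousLinearEquiv.symm_apply_apply]

variable {B' : Type*} [TopologicalSpace B'] (f : C(B', B))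

lemma Bundle.Trivialization.pullback_continuousLinearMapAt_apply [VectorBundle 𝕜 F E]
    (e : Trivialization F (π F E)) [e.IsLinear 𝕜] {b : B'} (h : f b ∈ e.baseSet) (v : E (f b)) :
    (e.pullback f).continuousLinearMapAt 𝕜 b v = e.continuousLinearMapAt 𝕜 (f b) v :=
  (continuousLinearMapAt_apply_of_mem 𝕜 (e.pullback f) h v).trans
    (continuousLinearMapAt_apply_of_mem 𝕜 e h v).symm

lemma Bundle.Trivialization.pullback_symmL_apply [VectorBundle 𝕜 F E]
    (e : Trivialization F (π F E)) [e.IsLinear 𝕜] {b : B'} (h : f b ∈ e.baseSet) (v : F) :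
    (e.pullback f).symmL 𝕜 b v = e.symmL 𝕜 (f b) v := by
  have h1 := (pullback_continuousLinearMapAt_apply f e h _).symm.trans
    ((e.pullback f).continuousLinearMapAt_symmL (R := 𝕜) (b := b) h v)
  have h2 := congrArg (e.symmL 𝕜 (f b)) h1
  exact (e.symmL_continuousLinearMapAt h _).symm.trans h2

end Trivializations

namespace CmFamily

open Filter

section BundleMatrix

variable {X 𝕜 : Type*} [TopologicalSpace X] [RCLike 𝕜] {r : ℕ} {E : X → Type*}
  [TopologicalSpace (TotalSpace (EuclideanSpace 𝕜 (Fin r)) E)]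
  [∀ x, AddCommMonoid (E x)] [∀ x, Module 𝕜 (E x)] [∀ x, TopologicalSpace (E x)]
  [FiberBundle (EuclideanSpace 𝕜 (Fin r)) E] [VectorBundle 𝕜 (EuclideanSpace 𝕜 (Fin r)) E]

/-- The matrix, in the trivializations `e₁` at `x` and `e₂` at `ρ x`, of the linear map from `E x` to
`E (ρ x)` obtained by gluing the identifications given by some local trivializations with the
weights `ψ`. -/
noncomputable def bundleMatrix (𝕜 : Type*) [RCLike 𝕜] {r : ℕ} {E : X → Type*}
    [TopologicalSpace (TotalSpace (EuclideanSpace 𝕜 (Fin r)) E)]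
    [∀ x, AddCommMonoid (E x)] [∀ x, Module 𝕜 (E x)] [∀ x, TopologicalSpace (E x)]
    [FiberBundle (EuclideanSpace 𝕜 (Fin r)) E] [VectorBundle 𝕜 (EuclideanSpace 𝕜 (Fin r)) E]
    (t : Finset X) (ψ : X → X → ℝ) (ρ : X → X)
    (e₁ e₂ : Trivialization (EuclideanSpace 𝕜 (Fin r)) (π (EuclideanSpace 𝕜 (Fin r)) E))
    [MemTrivializationAtlas e₁] [MemTrivializationAtlas e₂] (x : X) :
    EuclideanSpace 𝕜 (Fin r) →L[𝕜] EuclideanSpace 𝕜 (Fin r) :=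
  ∑ i ∈ t, ψ i x •
    (((trivializationAt (EuclideanSpace 𝕜 (Fin r)) E i).coordChangeL 𝕜 e₂ (ρ x) :
        EuclideanSpace 𝕜 (Fin r) →L[𝕜] EuclideanSpace 𝕜 (Fin r)) ∘L
      (e₁.coordChangeL 𝕜 (trivializationAt (EuclideanSpace 𝕜 (Fin r)) E i) x :
        EuclideanSpace 𝕜 (Fin r) →L[𝕜] EuclideanSpace 𝕜 (Fin r)))

variable {t : Finset X} {ψ : X → X → ℝ} {ρ : X → X}
  (e₁ e₂ e₁' e₂' : Trivialization (EuclideanSpace 𝕜 (Fin r)) (π (EuclideanSpace 𝕜 (Fin r)) E))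
  [MemTrivializationAtlas e₁] [MemTrivializationAtlas e₂]
  [MemTrivializationAtlas e₁'] [MemTrivializationAtlas e₂'] {x : X}

/-- The cocycle rule applied to each summand. Where `ψ i x = 0` the coordinate changes through `i`
may be meaningless, but the summand vanishes on both sides. -/
lemma bundleMatrix_change
    (hψ : ∀ i ∈ t, ψ i x ≠ 0 → x ∈ (trivializationAt (EuclideanSpace 𝕜 (Fin r)) E i).baseSet ∧
      ρ x ∈ (trivializationAt (EuclideanSpace 𝕜 (Fin r)) E i).baseSet)
    (h₁ : x ∈ e₁.baseSet) (h₁' : x ∈ e₁'.baseSet) (h₂ : ρ x ∈ e₂.baseSet)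
    (h₂' : ρ x ∈ e₂'.baseSet) :
    bundleMatrix 𝕜 t ψ ρ e₁' e₂' x = (e₂.coordChangeL 𝕜 e₂' (ρ x) :
        EuclideanSpace 𝕜 (Fin r) →L[𝕜] EuclideanSpace 𝕜 (Fin r)) ∘L
      bundleMatrix 𝕜 t ψ ρ e₁ e₂ x ∘L (e₁'.coordChangeL 𝕜 e₁ x :
        EuclideanSpace 𝕜 (Fin r) →L[𝕜] EuclideanSpace 𝕜 (Fin r)) := by
  ext1 v
  simp only [bundleMatrix, ContinuousLinearMap.comp_apply, sum_apply, map_sum]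
  refine Finset.sum_congr rfl fun i hi => ?_
  by_cases h0 : ψ i x = 0
  · simp [h0]
  · obtain ⟨h1, h2⟩ := hψ i hi h0
    simp only [smul_apply, ContinuousLinearMap.comp_apply,
      ContinuousLinearEquiv.coe_coe]
    rw [Trivialization.coordChangeL_coordChangeL e₁' e₁ _ h₁' h₁ h1,
      ← Trivialization.coordChangeL_coordChangeL _ e₂ e₂' h2 h₂ h₂']
    -- The weights are real, so the `𝕜`-linear map is viewed as `ℝ`-linear to move them across.
    exact (((e₂.coordChangeL 𝕜 e₂' (ρ x) : EuclideanSpace 𝕜 (Fin r) →L[𝕜]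
      EuclideanSpace 𝕜 (Fin r)).restrictScalars ℝ).map_smul _ _).symm

/-- When `ρ x = x`, every nonzero summand is the same coordinate change up to its weight. Only a
nonzero total weight will be needed, so the `ψ i` need not form a partition of unity. -/
lemma bundleMatrix_of_eq
    (hψ : ∀ i ∈ t, ψ i x ≠ 0 → x ∈ (trivializationAt (EuclideanSpace 𝕜 (Fin r)) E i).baseSet ∧
      ρ x ∈ (trivializationAt (EuclideanSpace 𝕜 (Fin r)) E i).baseSet)
    (h₁ : x ∈ e₁.baseSet) (h₂ : x ∈ e₂.baseSet) (hx : ρ x = x) :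
    bundleMatrix 𝕜 t ψ ρ e₁ e₂ x = (∑ i ∈ t, ψ i x) • (e₁.coordChangeL 𝕜 e₂ x :
        EuclideanSpace 𝕜 (Fin r) →L[𝕜] EuclideanSpace 𝕜 (Fin r)) := by
  refine Eq.trans ?_ (Finset.sum_smul (M := EuclideanSpace 𝕜 (Fin r) →L[𝕜]
    EuclideanSpace 𝕜 (Fin r))).symm
  refine Finset.sum_congr rfl fun i hi => ?_
  by_cases h0 : ψ i x = 0
  · rw [h0]
    exact (zero_smul ℝ (_ : EuclideanSpace 𝕜 (Fin r) →L[𝕜] EuclideanSpace 𝕜 (Fin r))).trans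
      (zero_smul ℝ (_ : EuclideanSpace 𝕜 (Fin r) →L[𝕜] EuclideanSpace 𝕜 (Fin r))).symm
  · obtain ⟨h1, h2⟩ := hψ i hi h0
    congr 1
    ext1 v
    rw [hx]
    exact Trivialization.coordChangeL_coordChangeL e₁ _ e₂ h₁ h1 h₂ v

/-- If the matrices `bundleMatrix` are invertible at `x`, they come from an isomorphism of `E x`
with `E (ρ x)`. -/
lemma exists_equiv_of_bundleMatrix
    (hψ : ∀ i ∈ t, ψ i x ≠ 0 → x ∈ (trivializationAt (EuclideanSpace 𝕜 (Fin r)) E i).baseSet ∧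
      ρ x ∈ (trivializationAt (EuclideanSpace 𝕜 (Fin r)) E i).baseSet)
    (hinv : ∀ (e₁ e₂ : Trivialization (EuclideanSpace 𝕜 (Fin r))
      (π (EuclideanSpace 𝕜 (Fin r)) E)) [MemTrivializationAtlas e₁] [MemTrivializationAtlas e₂],
      x ∈ e₁.baseSet → ρ x ∈ e₂.baseSet → (bundleMatrix 𝕜 t ψ ρ e₁ e₂ x).IsInvertible) :
    ∃ A : E x ≃L[𝕜] E (ρ x), ∀ (e₁ e₂ : Trivialization (EuclideanSpace 𝕜 (Fin r))
      (π (EuclideanSpace 𝕜 (Fin r)) E)) [MemTrivializationAtlas e₁] [MemTrivializationAtlas e₂],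
      x ∈ e₁.baseSet → ρ x ∈ e₂.baseSet →
        (e₂.continuousLinearMapAt 𝕜 (ρ x)) ∘L (A : E x →L[𝕜] E (ρ x)) ∘L (e₁.symmL 𝕜 x) =
          bundleMatrix 𝕜 t ψ ρ e₁ e₂ x ∧
        (e₁.continuousLinearMapAt 𝕜 x) ∘L (A.symm : E (ρ x) →L[𝕜] E x) ∘L (e₂.symmL 𝕜 (ρ x)) =
          (bundleMatrix 𝕜 t ψ ρ e₁ e₂ x).inverse := by
  let e := trivializationAt (EuclideanSpace 𝕜 (Fin r)) E x
  let e' := trivializationAt (EuclideanSpace 𝕜 (Fin r)) E (ρ x)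
  have he : x ∈ e.baseSet := mem_baseSet_trivializationAt _ _ _
  have he' : ρ x ∈ e'.baseSet := mem_baseSet_trivializationAt _ _ _
  obtain ⟨B, hB⟩ := hinv e e' he he'
  -- One pair of trivializations defines `A`; `bundleMatrix_change` identifies its matrix in all the
  -- others.
  let A : E x ≃L[𝕜] E (ρ x) := (e.continuousLinearEquivAt 𝕜 x he).trans
    (B.trans (e'.continuousLinearEquivAt 𝕜 (ρ x) he').symm)
  refine ⟨A, fun e₁ e₂ _ _ h₁ h₂ => ?_⟩
  let C := (e₁.continuousLinearEquivAt 𝕜 x h₁).symm.trans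
    (A.trans (e₂.continuousLinearEquivAt 𝕜 (ρ x) h₂))
  have hC : (C : EuclideanSpace 𝕜 (Fin r) →L[𝕜] EuclideanSpace 𝕜 (Fin r)) =
      bundleMatrix 𝕜 t ψ ρ e₁ e₂ x := by
    rw [bundleMatrix_change e e' e₁ e₂ hψ he h₁ he' h₂, ← hB,
      ← Trivialization.comp_continuousLinearEquivAt_eq_coord_change e₁ e ⟨h₁, he⟩,
      ← Trivialization.comp_continuousLinearEquivAt_eq_coord_change e' e₂ ⟨he', h₂⟩]
    ext1 v
    simp [C, A]
  constructor
  · rw [← hC, ← Trivialization.coe_continuousLinearEquivAt_eq' e₂ h₂,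
      ← Trivialization.symm_continuousLinearEquivAt_eq' e₁ h₁]
    rfl
  · rw [← hC, ContinuousLinearMap.inverse_equiv,
      ← Trivialization.coe_continuousLinearEquivAt_eq' e₁ h₁,
      ← Trivialization.symm_continuousLinearEquivAt_eq' e₂ h₂]
    rfl

end BundleMatrix

end CmFamily

/-! ### Isomorphism of a vector bundle with its pullback by an adapted retraction. -/

namespace CmFamily

open Filter

section BundleTrivialization

variable {m : ℕ∞} {n l : ℕ}
  {EX HX X : Type*} [NormedAddCommGroup EX] [NormedSpace ℝ EX] [TopologicalSpace HX]
  {I : ModelWithCorners ℝ EX HX} [TopologicalSpace X] [ChartedSpace HX X]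
  {S : Type*} [TopologicalSpace S] [ChartedSpace (EuclideanSpace ℝ (Fin l)) S]
  {α : X → S} {𝓕 : CmFamily m n I (𝓡 l) α}
  {G : Type*} [NormedAddCommGroup G] [NormedSpace ℝ G]

lemma AdaptedAt.sum {ι : Type*} {t : Finset ι} {f : ι → X → G} {x : X}
    (h : ∀ i ∈ t, 𝓕.AdaptedAt (f i) x) : 𝓕.AdaptedAt (fun y => ∑ i ∈ t, f i y) x := by
  classical
  induction t using Finset.induction_on with
  | empty => simpa using AdaptedAt.const (0 : G) x
  | insert a t ha ih =>
    simp only [Finset.sum_insert ha]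
    exact ((h a (Finset.mem_insert_self a t)).prodMk
      (ih fun i hi => h i (Finset.mem_insert_of_mem hi))).comp_contDiff
      (φ := fun z : G × G => z.1 + z.2) (Eventually.of_forall fun z => by fun_prop)

/-- Since `q` has values in one fibre, only the smoothness of `f` along that fibre matters; the
regularity in the parameter comes from `q`. -/
lemma AdaptedOn.comp_adaptedMapAt {s₀ : S} {q : X → 𝓕.Fiber s₀} {x : X}
    (hq : 𝓕.AdaptedMapAt q x) {f : X → G} {O : Set X} (hf : 𝓕.AdaptedOn f O) (hO : IsOpen O)
    (hx : (q x).1 ∈ O) : 𝓕.AdaptedAt (fun y => f (q y).1) x := by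
  obtain ⟨Φ, hΦ, hxΦ⟩ := 𝓕.exists_mem_source (q x).1
  set φ := 𝓕.fiberChart s₀ Φ hΦ with hφ_def
  have hqx : q x ∈ φ.source := hxΦ
  refine hq.comp (c := fun y => f y.1) (fiberChart_mem_atlas 𝓕 s₀ hΦ) hqx ?_
  have hev : ∀ᶠ v in 𝓝 (φ (q x)), v ∈ φ.target ∧ (φ.symm v).1 ∈ O :=
    (φ.open_target.eventually_mem (φ.map_source hqx)).and ((φ.tendsto_symm hqx).eventually
      ((𝓕.fiberIncl s₀).continuous.continuousAt.eventually (hO.eventually_mem hx)))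
  filter_upwards [hev] with v ⟨hv, hvO⟩
  rw [𝓕.fiberChart_symm_val s₀ Φ hΦ hv] at hvO
  refine ((hf Φ hΦ).1 (v, s₀) ⟨hv, hvO⟩).congr_of_eventuallyEq ?_
  filter_upwards [φ.open_target.eventually_mem hv] with w hw
  rw [𝓕.fiberChart_symm_val s₀ Φ hΦ hw]

variable {𝕜 : Type*} [RCLike 𝕜] {r : ℕ} {E : X → Type*}
  [TopologicalSpace (TotalSpace (EuclideanSpace 𝕜 (Fin r)) E)]
  [∀ x, AddCommMonoid (E x)] [∀ x, Module 𝕜 (E x)] [∀ x, TopologicalSpace (E x)]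
  [FiberBundle (EuclideanSpace 𝕜 (Fin r)) E] [VectorBundle 𝕜 (EuclideanSpace 𝕜 (Fin r)) E]

lemma contDiff_smul_clm_comp : ContDiff ℝ ∞
    (fun z : ℝ × (EuclideanSpace 𝕜 (Fin r) →L[𝕜] EuclideanSpace 𝕜 (Fin r)) ×
      (EuclideanSpace 𝕜 (Fin r) →L[𝕜] EuclideanSpace 𝕜 (Fin r)) => z.1 • (z.2.1 ∘L z.2.2)) := by
  have h : ContDiff 𝕜 ∞ (fun z : (EuclideanSpace 𝕜 (Fin r) →L[𝕜] EuclideanSpace 𝕜 (Fin r)) ×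
      (EuclideanSpace 𝕜 (Fin r) →L[𝕜] EuclideanSpace 𝕜 (Fin r)) => z.1 ∘L z.2) :=
    contDiff_fst.clm_comp contDiff_snd
  exact contDiff_fst.smul ((h.restrict_scalars ℝ).comp contDiff_snd)

/-- If `x ∈ C i`, both coordinate changes in the summand are adapted, one at `x` and one pulled back
by `q`. Otherwise the summand vanishes near `x`, as `C i` is closed. -/
lemma adaptedAt_bundleMatrix (hE : 𝓕.IsVectorBundleFamily 𝕜 r E) {s₀ : S} {q : X → 𝓕.Fiber s₀}
    {x : X} (hq : 𝓕.AdaptedMapAt q x) {t : Finset X} {ψ : X → X → ℝ} {C : X → Set X}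
    (hC : ∀ i ∈ t, IsClosed (C i)) (hψ : ∀ i ∈ t, 𝓕.AdaptedAt (ψ i) x)
    (hψC : ∀ i ∈ t, ∀ y ∉ C i, ψ i y = 0)
    (hCe : ∀ i ∈ t, x ∈ C i → x ∈ (trivializationAt (EuclideanSpace 𝕜 (Fin r)) E i).baseSet ∧
      (q x).1 ∈ (trivializationAt (EuclideanSpace 𝕜 (Fin r)) E i).baseSet)
    (e₁ e₂ : Trivialization (EuclideanSpace 𝕜 (Fin r)) (π (EuclideanSpace 𝕜 (Fin r)) E))
    [MemTrivializationAtlas e₁] [MemTrivializationAtlas e₂]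
    (h₁ : x ∈ e₁.baseSet) (h₂ : (q x).1 ∈ e₂.baseSet) :
    𝓕.AdaptedAt (bundleMatrix 𝕜 t ψ (fun y => (q y).1) e₁ e₂) x := by
  refine AdaptedAt.sum fun i hi => ?_
  by_cases hxC : x ∈ C i
  · obtain ⟨hi1, hi2⟩ := hCe i hi hxC
    set e := trivializationAt (EuclideanSpace 𝕜 (Fin r)) E i
    have ha := (hE e₁ e).adaptedAt (e₁.open_baseSet.inter e.open_baseSet) ⟨h₁, hi1⟩
    have hb := (hE e e₂).comp_adaptedMapAt hq (e.open_baseSet.inter e₂.open_baseSet) ⟨hi2, h₂⟩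
    exact ((hψ i hi).prodMk (hb.prodMk ha)).comp_contDiff
      (Eventually.of_forall fun z => contDiff_smul_clm_comp.contDiffAt)
  · refine (AdaptedAt.const 0 x).congr ?_
    filter_upwards [(hC i hi).isOpen_compl.eventually_mem hxC] with y hy
    rw [hψC i hi y hy]
    exact zero_smul ℝ (_ : EuclideanSpace 𝕜 (Fin r) →L[𝕜] EuclideanSpace 𝕜 (Fin r))

lemma isInvertible_bundleMatrix_change {t : Finset X} {ψ : X → X → ℝ} {ρ : X → X} {x : X}
    (e₁ e₂ e₁' e₂' : Trivialization (EuclideanSpace 𝕜 (Fin r)) (π (EuclideanSpace 𝕜 (Fin r)) E))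
    [MemTrivializationAtlas e₁] [MemTrivializationAtlas e₂]
    [MemTrivializationAtlas e₁'] [MemTrivializationAtlas e₂']
    (hψ : ∀ i ∈ t, ψ i x ≠ 0 → x ∈ (trivializationAt (EuclideanSpace 𝕜 (Fin r)) E i).baseSet ∧
      ρ x ∈ (trivializationAt (EuclideanSpace 𝕜 (Fin r)) E i).baseSet)
    (h₁ : x ∈ e₁.baseSet) (h₁' : x ∈ e₁'.baseSet) (h₂ : ρ x ∈ e₂.baseSet)
    (h₂' : ρ x ∈ e₂'.baseSet) (h : (bundleMatrix 𝕜 t ψ ρ e₁ e₂ x).IsInvertible) :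
    (bundleMatrix 𝕜 t ψ ρ e₁' e₂' x).IsInvertible := by
  obtain ⟨B, hB⟩ := h
  rw [bundleMatrix_change e₁ e₂ e₁' e₂' hψ h₁ h₁' h₂ h₂', ← hB]
  exact ⟨(e₁'.coordChangeL 𝕜 e₁ x).trans (B.trans (e₂.coordChangeL 𝕜 e₂' (ρ x))), rfl⟩

/-- A vector bundle on a family of compact manifolds is isomorphic, near a fibre, to its pullback by
an adapted retraction. -/
lemma exists_bundleMatrix [T2Space X] [T1Space S] (hα : IsProperMap α)
    (hE : 𝓕.IsVectorBundleFamily 𝕜 r E) {s₀ : S} {q : X → 𝓕.Fiber s₀}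
    (hqs : ∀ x (h : α x = s₀), q x = ⟨x, h⟩)
    (hq : ∀ᶠ s in 𝓝 s₀, ∀ x, α x = s → 𝓕.AdaptedMapAt q x) :
    ∃ (t : Finset X) (ψ : X → X → ℝ), ∀ᶠ s in 𝓝 s₀, ∀ x, α x = s →
      (∀ i ∈ t, ψ i x ≠ 0 → x ∈ (trivializationAt (EuclideanSpace 𝕜 (Fin r)) E i).baseSet ∧
        (q x).1 ∈ (trivializationAt (EuclideanSpace 𝕜 (Fin r)) E i).baseSet) ∧
      ∀ (e₁ e₂ : Trivialization (EuclideanSpace 𝕜 (Fin r)) (π (EuclideanSpace 𝕜 (Fin r)) E))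
        [MemTrivializationAtlas e₁] [MemTrivializationAtlas e₂],
        x ∈ e₁.baseSet → (q x).1 ∈ e₂.baseSet →
          𝓕.AdaptedAt (bundleMatrix 𝕜 t ψ (fun y => (q y).1) e₁ e₂) x ∧
            (bundleMatrix 𝕜 t ψ (fun y => (q y).1) e₁ e₂ x).IsInvertible := by
  let e : ∀ i : X, Trivialization (EuclideanSpace 𝕜 (Fin r)) (π (EuclideanSpace 𝕜 (Fin r)) E) :=
    trivializationAt (EuclideanSpace 𝕜 (Fin r)) E
  have hqc : ∀ x, α x = s₀ → ContinuousAt (fun y => (q y).1) x := fun x hx =>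
    ContinuousAt.comp (g := 𝓕.fiberIncl s₀) (𝓕.fiberIncl s₀).continuous.continuousAt
      (hq.self_of_nhds x hx).continuousAt
  have hqx : ∀ x, α x = s₀ → (q x).1 = x := fun x hx => by rw [hqs x hx]
  -- The cutoff at `x` is supported where a single trivialization covers both `z` and `q z`.
  have hO : ∀ x, α x = s₀ → {z | z ∈ (e x).baseSet ∧ (q z).1 ∈ (e x).baseSet} ∈ 𝓝 x := by
    intro x hx
    have h1 : x ∈ (e x).baseSet := mem_baseSet_trivializationAt _ _ _
    refine inter_mem ((e x).open_baseSet.mem_nhds h1) ((hqc x hx).eventually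
      ((e x).open_baseSet.eventually_mem ?_))
    change (q x).1 ∈ (e x).baseSet
    rwa [hqx x hx]
  have hcut := fun x hx => 𝓕.exists_cutoff (hO x hx)
  choose! ψ C hC hCO hψ0 hψC hψ1 W hW hWo hψW using hcut
  have hK : IsCompact (α ⁻¹' {s₀}) := hα.isCompact_preimage isCompact_singleton
  obtain ⟨t, ht, htN⟩ := hK.elim_nhds_subcover (fun x => {z | ψ x z = 1}) hψ1
  refine ⟨t, ψ, ?_⟩
  have hne : ∀ x, ∀ i ∈ t, ψ i x ≠ 0 → x ∈ (e i).baseSet ∧ (q x).1 ∈ (e i).baseSet := by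
    intro x i hi h0
    by_contra hcon
    exact h0 (hψC i (ht i hi) x fun hxC => hcon (hCO i (ht i hi) hxC))
  have hA : ∀ᶠ s in 𝓝 s₀, ∀ x, α x = s →
      ∀ (e₁ e₂ : Trivialization (EuclideanSpace 𝕜 (Fin r)) (π (EuclideanSpace 𝕜 (Fin r)) E))
        [MemTrivializationAtlas e₁] [MemTrivializationAtlas e₂],
        x ∈ e₁.baseSet → (q x).1 ∈ e₂.baseSet →
          𝓕.AdaptedAt (bundleMatrix 𝕜 t ψ (fun y => (q y).1) e₁ e₂) x := by
    have hWt : ∀ᶠ s in 𝓝 s₀, ∀ i ∈ t, s ∈ W i := by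
      refine (Filter.eventually_all_finset t).2 fun i hi => ?_
      have := hW i (ht i hi)
      rwa [show α i = s₀ from ht i hi] at this
    filter_upwards [hq, hWt] with s hs hsW x hx e₁ e₂ _ _ h₁ h₂
    exact adaptedAt_bundleMatrix hE (hs x hx) (fun i hi => hC i (ht i hi))
      (fun i hi => hψW i (ht i hi) x (hx ▸ hsW i hi)) (fun i hi => hψC i (ht i hi))
      (fun i hi hxC => hCO i (ht i hi) hxC) e₁ e₂ h₁ h₂
  -- At a point of `X_{s₀}` one matrix is shown invertible. It stays so nearby by continuity,
  -- `isInvertible_bundleMatrix_change` covers the other trivializations, and properness reaches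
  -- whole fibres.
  have hI : ∀ᶠ s in 𝓝 s₀, ∀ x, α x = s →
      ∀ (e₁ e₂ : Trivialization (EuclideanSpace 𝕜 (Fin r)) (π (EuclideanSpace 𝕜 (Fin r)) E))
        [MemTrivializationAtlas e₁] [MemTrivializationAtlas e₂],
        x ∈ e₁.baseSet → (q x).1 ∈ e₂.baseSet →
          (bundleMatrix 𝕜 t ψ (fun y => (q y).1) e₁ e₂ x).IsInvertible := by
    refine eventually_forall_fiber hα fun x hx => ?_
    have hxe : x ∈ (e x).baseSet := mem_baseSet_trivializationAt _ _ _
    have hqe : (q x).1 ∈ (e x).baseSet := by rwa [hqx x hx]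
    -- The weights are nonnegative and one of them equals `1` at `x`, by the choice of the cover.
    have hpos : (∑ i ∈ t, ψ i x) ≠ 0 := by
      obtain ⟨i, hi, hix⟩ := mem_iUnion₂.1 (htN hx)
      have h1 : ψ i x = 1 := hix
      have h2 := Finset.single_le_sum (f := fun i => ψ i x) (fun i hi => hψ0 i (ht i hi) x) hi
      simp only [h1] at h2
      linarith
    have hinv : (bundleMatrix 𝕜 t ψ (fun y => (q y).1) (e x) (e x) x).IsInvertible := by
      rw [bundleMatrix_of_eq (ρ := fun y => (q y).1) (e x) (e x) (hne x) hxe hxe (hqx x hx)]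
      have h1 : ((∑ i ∈ t, ψ i x : ℝ) : 𝕜) ≠ 0 := by exact_mod_cast hpos
      refine ⟨((e x).coordChangeL 𝕜 (e x) x).trans
        (ContinuousLinearEquiv.smulLeft (Units.mk0 _ h1)), ?_⟩
      ext1 v
      exact (RCLike.real_smul_eq_coe_smul (K := 𝕜) _ _).symm
    have hcont := ((hA.self_of_nhds x hx) (e x) (e x) hxe hqe).continuousAt
    filter_upwards [hcont.eventually hinv.eventually, hO x hx] with z hz hzO e₁ e₂ _ _ h₁ h₂
    exact isInvertible_bundleMatrix_change (e x) (e x) e₁ e₂ (hne z) hzO.1 h₁ hzO.2 h₂ hz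
  filter_upwards [hA, hI] with s hsA hsI x hx
  exact ⟨hne x, fun e₁ e₂ _ _ h₁ h₂ => ⟨hsA x hx e₁ e₂ h₁ h₂, hsI x hx e₁ e₂ h₁ h₂⟩⟩

end BundleTrivialization

end CmFamily

/-! ### The local triviality theorem. -/

theorem mainTheorem8 (m : ℕ∞) (n d l : ℕ)
    {X : Type*} [TopologicalSpace X] [T2Space X]
    [ChartedSpace (EuclideanSpace ℝ (Fin d)) X] [IsManifold (𝓡 d) m X]
    {S : Type*} [TopologicalSpace S] [T2Space S]
    [ChartedSpace (EuclideanSpace ℝ (Fin l)) S] [IsManifold (𝓡 l) m S]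
    {α : X → S} (𝓕 : CmFamily m n (𝓡 d) (𝓡 l) α) (hα : IsProperMap α)
    (𝕜 : Type*) [RCLike 𝕜] (r : ℕ)
    (E : X → Type*) [TopologicalSpace (TotalSpace (EuclideanSpace 𝕜 (Fin r)) E)]
    [∀ x, AddCommMonoid (E x)] [∀ x, Module 𝕜 (E x)] [∀ x, TopologicalSpace (E x)]
    [FiberBundle (EuclideanSpace 𝕜 (Fin r)) E] [VectorBundle 𝕜 (EuclideanSpace 𝕜 (Fin r)) E]
    (hE : 𝓕.IsVectorBundleFamily 𝕜 r E) (s₀ : S) :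
    ∃ U₀ : Opens S, s₀ ∈ U₀ ∧ ∀ (U : Opens S) (hs : s₀ ∈ U), U ≤ U₀ →
      ∃ Θ : (𝓕.restrict U).Iso (CmFamily.prod (𝓕.Fiber s₀) (𝓡 l) U m),
        (∀ (x : X) (hx : α x = s₀),
          Θ.toHomeomorph ⟨x, show α x ∈ U from hx.symm ▸ hs⟩ = (⟨x, hx⟩, ⟨s₀, hs⟩)) ∧
        Nonempty ((𝓕.restrict U).VectorBundleIso 𝕜 r
          (𝓕.preimIncl U *ᵖ E) (Θ.toFst *ᵖ (𝓕.fiberIncl s₀ *ᵖ E))) := by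
  obtain ⟨q, hqs, hq⟩ := 𝓕.exists_trivializing_retraction hα s₀
  obtain ⟨t, ψ, hB⟩ := CmFamily.exists_bundleMatrix (𝕜 := 𝕜) (r := r) (E := E) hα hE hqs
    (hq.mono fun s hs x hx => (hs.1 x hx).adaptedMapAt)
  -- Every property in `hΩ` concerns a single fibre, so the same `q` and weights serve for all `U ⊆
  -- Ω`.
  obtain ⟨Ω, hΩ, hΩo, hs₀⟩ := eventually_nhds_iff.1 (hq.and hB)
  refine ⟨⟨Ω, hΩo⟩, hs₀, fun U hs hU => ?_⟩
  have het : ∀ x : 𝓕.preim U, (𝓕.restrict U).VertEtaleAt (fun y => q y.1) x := fun x =>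
    ((hΩ (α x.1) (hU x.2)).1.1 x.1 rfl).restrict
  have hbij : Function.Bijective fun x : 𝓕.preim U => (q x.1, 𝓕.preimProj U x) := by
    constructor
    · intro x y hxy
      have h1 : q x.1 = q y.1 := congrArg Prod.fst hxy
      have h2 : α x.1 = α y.1 := congrArg (fun z => z.2.1) hxy
      exact Subtype.ext (((hΩ (α x.1) (hU x.2)).1.2 (q x.1)).unique ⟨rfl, rfl⟩
        ⟨h2.symm, h1.symm⟩)
    · rintro ⟨y, s, hsU⟩
      obtain ⟨x, ⟨hx, hxy⟩, -⟩ := (hΩ s (hU hsU)).1.2 y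
      exact ⟨⟨x, show α x ∈ U from hx.symm ▸ hsU⟩, Prod.ext hxy (Subtype.ext hx)⟩
  refine ⟨CmFamily.isoOfVertEtale het hbij, fun x hx => Prod.ext (hqs x hx) (Subtype.ext hx), ?_⟩
  -- Choosing pointwise loses no regularity: `hA` equates the matrices of `A x` with the adapted
  -- `bundleMatrix`.
  choose A hA using fun x : 𝓕.preim U =>
    CmFamily.exists_equiv_of_bundleMatrix (𝕜 := 𝕜) (E := E) (ρ := fun y => (q y).1)
      ((hΩ (α x.1) (hU x.2)).2 x.1 rfl).1
      (fun e₁ e₂ _ _ h₁ h₂ => (((hΩ (α x.1) (hU x.2)).2 x.1 rfl).2 e₁ e₂ h₁ h₂).2)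
  refine ⟨⟨fun x => A x, ?_, ?_⟩⟩
  -- Trivializations in the atlas of a pullback bundle are pullbacks, here once for `E` over
  -- `α⁻¹(U)` and twice for `q^*(E_{s₀})`.
  · rintro _ _ ⟨e₁, he₁, rfl⟩ ⟨_, ⟨e₂, he₂, rfl⟩, rfl⟩
    refine CmFamily.AdaptedAt.adaptedOn fun x hx => ?_
    have hopen := ((e₁.pullback (𝓕.preimIncl U)).open_baseSet.inter
      ((e₂.pullback (𝓕.fiberIncl s₀)).pullback
        (CmFamily.isoOfVertEtale het hbij).toFst).open_baseSet)
    refine ((((hΩ (α x.1) (hU x.2)).2 x.1 rfl).2 e₁ e₂ hx.1 hx.2).1.restrict (U := U)).congr ?_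
    filter_upwards [hopen.eventually_mem hx] with y hy
    refine Eq.trans ?_ (hA y e₁ e₂ hy.1 hy.2).1
    ext1 v
    exact (Trivialization.pullback_continuousLinearMapAt_apply _
        (e₂.pullback (𝓕.fiberIncl s₀)) hy.2 _).trans
      ((Trivialization.pullback_continuousLinearMapAt_apply _ e₂ hy.2 _).trans
        (congrArg (fun w => e₂.continuousLinearMapAt 𝕜 (q y.1).1 (A y w))
          (Trivialization.pullback_symmL_apply (𝓕.preimIncl U) e₁ hy.1 v)))
  · rintro _ _ ⟨e₁, he₁, rfl⟩ ⟨_, ⟨e₂, he₂, rfl⟩, rfl⟩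
    refine CmFamily.AdaptedAt.adaptedOn fun x hx => ?_
    have hopen := ((e₁.pullback (𝓕.preimIncl U)).open_baseSet.inter
      ((e₂.pullback (𝓕.fiberIncl s₀)).pullback
        (CmFamily.isoOfVertEtale het hbij).toFst).open_baseSet)
    obtain ⟨had, hinv⟩ := ((hΩ (α x.1) (hU x.2)).2 x.1 rfl).2 e₁ e₂ hx.1 hx.2
    -- Inversion of matrices is smooth over `𝕜`, hence over `ℝ`, so the inverse matrix is adapted
    -- too.
    have hsm := hinv.eventually.mono fun B hB =>
      (hB.contDiffAt_map_inverse (n := ∞)).restrict_scalars ℝ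
    refine ((had.comp_contDiff hsm).restrict (U := U)).congr ?_
    filter_upwards [hopen.eventually_mem hx] with y hy
    refine Eq.trans ?_ (hA y e₁ e₂ hy.1 hy.2).2
    ext1 v
    exact (Trivialization.pullback_continuousLinearMapAt_apply (𝓕.preimIncl U) e₁ hy.1 _).trans
      (congrArg (fun w => e₁.continuousLinearMapAt 𝕜 y.1 ((A y).symm w))
        ((Trivialization.pullback_symmL_apply _ (e₂.pullback (𝓕.fiberIncl s₀)) hy.2 v).trans
          (Trivialization.pullback_symmL_apply (𝓕.fiberIncl s₀) e₂ hy.2 v)))
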